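/- Let $n\ge 1$. On $\mathbb{R}^n\times\mathbb{R}$, with points $(x,\upsilon)$, consider the vector fields $X_j=\partial_{x_j}$ and $U_j=x_j\,\partial_{\upsilon}$, $j=1,\dots,n$. For a tangent vector $v$ at $p$ put $$\|v\|_p^2=\inf\Big\{\sum_{j=1}^n(\alpha_j^2+\beta_j^2):\ v=\sum_{j=1}^n\big(\alpha_jX_j(p)+\beta_jU_j(p)\big)\Big\},\qquad \inf\varnothing=\infty .$$ A horizontal curve is an absolutely continuous curve $\gamma:[0,1]\to\mathbb{R}^n\times\mathbb{R}$ with $\dot\gamma(t)\in\operatorname{span}\{X_j(\gamma(t)),U_j(\gamma(t)) : 1\le j\le n\}$ for almost every $t$; its length is $L(\gamma)=\int_0^1\|\dot\gamma(t)\|_{\gamma(t)}\,dt$ (and the length of its part over $[r,s]$ is the integral over $[r,s]$). The Carnot–Carathéodory distance $d_{CC}(p,q)$ is the infimum of $L(\gamma)$ over all horizontal curves with $\gamma(0)=p$, $\gamma(1)=q$. A geodesic is a horizontal curve $\gamma:[0,1]\to\mathbb{R}^n\times\mathbb{R}$ with $\|\dot\gamma(t)\|_{\gamma(t)}$ almost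 everywhere equal to a finite constant, which is locally length minimizing: every $t\in[0,1]$ has a neighbourhood in $[0,1]$ such that for all $r\le s$ in it the part of $\gamma$ over $[r,s]$ has length $d_{CC}(\gamma(r),\gamma(s))$. For $b\neq0$ and $c\in\mathbb{R}^n$ let $\gamma^{b,c}:[0,1]\to\mathbb{R}^n\times\mathbb{R}$ be the curve $$\gamma^{b,c}(t)=\Big(\frac{\sin(bt)}{b}\,c,\ \frac{|c|^2}{b}\Big(\frac t2-\frac{\sin(2bt)}{4b}\Big)\Big).$$ **Theorem.** Let $u>0$. The geodesics joining $(0,0)$ to $(0,u)$ are exactly the curves $\gamma^{m\pi,c_m}$ with $m\in\{1,2,3,\dots\}$, $c_m\in\mathbb{R}^n$ and $|c_m|=\sqrt{2m\pi u}$; there are infinitely many of them, and their lengths are $$L(\gamma^{m\pi,c_m})=\sqrt{2m\pi u}.$$ In particular, the shortest geodesics joining $(0,0)$ to $(0,u)$ are exactly the curves $\gamma^{\pi,c_1}$ with $|c_1|=\sqrt{2\pi u}$, their length equals the Carnot–Carathéodory distance, and $$d_{CC}\big((0,0),(0,u)\big)=\sqrt{2\pi u}.$$ -/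

import Mathlib

open scoped ENNReal NNReal
open MeasureTheory Set

noncomputable section

namespace Grushin

section SubRiemannian

/-! Sub-Riemannian geometry of a finite family `V` of vector fields on a normed space `E`. -/

variable {E ι : Type*} [NormedAddCommGroup E] [NormedSpace ℝ E] [Fintype ι]

/-- `‖v‖ₚ² = inf {∑ αⱼ² : v = ∑ αⱼ Vⱼ(p)}`, which is `∞` if `v` is not in the span of the
`Vⱼ(p)`. -/
def normSq (V : ι → E → E) (p v : E) : ℝ≥0∞ :=
  ⨅ (α : ι → ℝ) (_ : v = ∑ j, α j • V j p), ENNReal.ofReal (∑ j, α j ^ 2)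

/-- `‖v‖ₚ`, the square root of `normSq`. -/
def vecNorm (V : ι → E → E) (p v : E) : ℝ≥0∞ :=
  normSq V p v ^ (1 / 2 : ℝ)

/-- Horizontal curves `[0,1] → E`: absolutely continuous curves whose velocity lies a.e. in the
span of the vector fields. Only the values of `γ` on `[0,1]` matter. -/
structure IsHorizontal (V : ι → E → E) (γ : ℝ → E) : Prop where
  ac : AbsolutelyContinuousOnInterval γ 0 1
  tangent : ∀ᵐ t ∂(volume.restrict (Icc (0 : ℝ) 1)),
    deriv γ t ∈ Submodule.span ℝ (range fun j => V j (γ t))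

/-- Length of the part of `γ` over `[a,b]`. -/
def lengthOn (V : ι → E → E) (γ : ℝ → E) (a b : ℝ) : ℝ≥0∞ :=
  ∫⁻ t in Icc a b, vecNorm V (γ t) (deriv γ t)

/-- Length of a curve `γ : [0,1] → E`. -/
def length (V : ι → E → E) (γ : ℝ → E) : ℝ≥0∞ :=
  lengthOn V γ 0 1

/-- Carnot–Carathéodory distance: the infimum of the lengths of the horizontal curves
`γ : [0,1] → E` from `p` to `q` (`∞` if there are none). -/
def dCC (V : ι → E → E) (p q : E) : ℝ≥0∞ :=
  ⨅ (γ : ℝ → E) (_ : IsHorizontal V γ ∧ γ 0 = p ∧ γ 1 = q), length V γ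

/-- Geodesics `[0,1] → E`: horizontal curves that are parametrized proportionally to arc length
and are locally length minimizing, i.e. every `t ∈ [0,1]` has a neighbourhood in `[0,1]` such that
`γ` is a shortest curve between any two of its points with parameters in this neighbourhood. -/
structure IsGeodesic (V : ι → E → E) (γ : ℝ → E) : Prop where
  horizontal : IsHorizontal V γ
  constSpeed : ∃ v : ℝ≥0, ∀ᵐ t ∂(volume.restrict (Icc (0 : ℝ) 1)),
    vecNorm V (γ t) (deriv γ t) = v
  locallyMinimizing : ∀ t ∈ Icc (0 : ℝ) 1, ∃ ε > 0, ∀ r ∈ Icc (0 : ℝ) 1, ∀ s ∈ Icc (0 : ℝ) 1,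
    |r - t| < ε → |s - t| < ε → r ≤ s → lengthOn V γ r s = dCC V (γ r) (γ s)

/-- `γ` is a geodesic joining `p` to `q`. -/
def IsGeodesicFromTo (V : ι → E → E) (γ : ℝ → E) (p q : E) : Prop :=
  IsGeodesic V γ ∧ γ 0 = p ∧ γ 1 = q

/-- `γ` is a geodesic joining `p` to `q`, and no geodesic joining `p` to `q` is shorter. -/
def IsShortestGeodesicFromTo (V : ι → E → E) (γ : ℝ → E) (p q : E) : Prop :=
  IsGeodesicFromTo V γ p q ∧
    ∀ γ' : ℝ → E, IsGeodesicFromTo V γ' p q → length V γ ≤ length V γ'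

end SubRiemannian

/-- The space `ℝⁿ × ℝ` with points `(x, u)`. -/
abbrev Space (n : ℕ) : Type := EuclideanSpace ℝ (Fin n) × ℝ

/-- The vector fields `Xⱼ = ∂/∂xⱼ` (left summand) and `Uⱼ = xⱼ ∂/∂u` (right summand). -/
def fields (n : ℕ) : Fin n ⊕ Fin n → Space n → Space n
  | Sum.inl j, _ => (EuclideanSpace.single j 1, 0)
  | Sum.inr j, p => (0, p.1 j)

/-- The curve `γ^{b,c}` starting in `(x₁, u₁)`. -/
def curve {n : ℕ} (x₁ : EuclideanSpace ℝ (Fin n)) (u₁ b : ℝ) (c : EuclideanSpace ℝ (Fin n))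
    (t : ℝ) : Space n :=
  if b = 0 then (t • c + x₁, u₁)
  else
    ((Real.sin (b * t) / b) • c + Real.cos (b * t) • x₁,
      ‖c‖ ^ 2 / b * (t / 2 - Real.sin (2 * b * t) / (4 * b))
        + inner ℝ x₁ c / b * Real.sin (b * t) ^ 2
        + ‖x₁‖ ^ 2 * b * (t / 2 + Real.sin (2 * b * t) / (4 * b)) + u₁)

end Grushin

end

/-! Two independent arguments carry the theorem: a calibration shows that the explicit curves are
minimizing, and a calculus of variations argument shows that there are no other geodesics.

Calibration. The quadratic function `S(t, (x, υ)) = b υ + a(t) ‖x‖² / 2 + q(t) ⟨w, x⟩ + d(t)` solves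
the Hamilton–Jacobi equation `∂ₜS + (‖∂ₓS‖² + ‖x‖² (∂_υ S)²) / 2 = 0` when `a`, `q`, `d` satisfy a
small Riccati system. Along a horizontal curve of length less than `M`, traversed in the time
interval `[r, s]`, `S` then grows by at most `M² / (2 (s - r))` (`IsHorizontal.calibration`). The
system has the solution `a = -b tan (b (t - μ))`, `q = 1 / cos (b (t - μ))`, which lives on
intervals of length less than `π / b`; for a suitable `w` equality is attained along `γ^{b,c}`.
Hence arcs of `γ^{b,c}` over such intervals are shortest (`dCC_curve`). With `w = 0` and `b ↑ π`,
the same inequality gives the lower bound `√(2πu)` for the distance (`le_length_vertical`), which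
`γ^{π,c}` attains.

Classification. A geodesic has controls `α = ẋ`, `β` of constant total norm. For a prescribed path
`x` the cheapest `β` reaching a given height is a constant multiple of `x`, so short pieces minimize
`∫ ‖ẋ‖² + D² / ∫ ‖x‖²`, with `D` the height gained. The first variation, in the integrated form of
du Bois-Reymond since `ẋ` is only measurable, yields `β = l x` and `ẋ = C - l² ∫ x`
(`exists_eulerLagrangeOn_of_sub_lt`). The constants agree on overlapping pieces, so these equations
hold on all of `[0, 1]`, and `x 0 = 0` forces `x = (sin (l t) / l) C`. The endpoint `(0, u)` with `u
> 0` then requires `l = mπ` and `‖C‖² = 2mπu`. -/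

namespace Grushin

/-! ### The sub-Riemannian norm in closed form -/

section VecNorm

variable {n : ℕ}

theorem sum_fields (p : Space n) (α : Fin n ⊕ Fin n → ℝ) :
    ∑ j, α j • fields n j p =
      (WithLp.toLp 2 fun j => α (Sum.inl j), ∑ j, α (Sum.inr j) * p.1 j) := by
  rw [Fintype.sum_sum_type]
  ext i
  · simp [fields, Prod.fst_sum, Finset.sum_apply, Pi.single_apply]
  · simp [fields, Prod.snd_sum]

theorem mem_span_fields_iff {p v : Space n} :
    v ∈ Submodule.span ℝ (range fun j => fields n j p) ↔
      ∃ β : EuclideanSpace ℝ (Fin n), v.2 = inner ℝ β p.1 := by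
  rw [Submodule.mem_span_range_iff_exists_fun]
  constructor
  · rintro ⟨α, rfl⟩
    refine ⟨WithLp.toLp 2 fun j => α (Sum.inr j), ?_⟩
    rw [sum_fields]
    simp [PiLp.inner_apply, mul_comm]
  · rintro ⟨β, hβ⟩
    refine ⟨Sum.elim (fun j => v.1 j) (fun j => β j), ?_⟩
    rw [sum_fields]
    refine Prod.ext ?_ ?_
    · ext i; simp
    · simp [hβ, PiLp.inner_apply, mul_comm]

theorem vecNorm_fields_le {p v : Space n} (β : EuclideanSpace ℝ (Fin n))
    (h : v.2 = inner ℝ β p.1) :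
    vecNorm (fields n) p v ≤ ENNReal.ofReal √(‖v.1‖ ^ 2 + ‖β‖ ^ 2) := by
  have h1 : normSq (fields n) p v ≤ ENNReal.ofReal (‖v.1‖ ^ 2 + ‖β‖ ^ 2) := by
    refine iInf₂_le_of_le (Sum.elim (fun j => v.1 j) (fun j => β j)) ?_ ?_
    · rw [sum_fields]
      refine Prod.ext ?_ ?_
      · ext i; simp
      · simp [h, PiLp.inner_apply, mul_comm]
    · rw [Fintype.sum_sum_type, EuclideanSpace.norm_sq_eq, EuclideanSpace.norm_sq_eq]
      simp
  rw [vecNorm, Real.sqrt_eq_rpow, ← ENNReal.ofReal_rpow_of_nonneg (by positivity) (by norm_num)]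
  gcongr

/-- Cauchy–Schwarz applied to `v.2 = ⟨β, p.1⟩`. No tangency is needed: the norm is `∞` for
non-tangent `v`, and for `p.1 = 0` the quotient has the default value `0`. -/
theorem le_vecNorm_fields (p v : Space n) :
    ENNReal.ofReal √(‖v.1‖ ^ 2 + v.2 ^ 2 / ‖p.1‖ ^ 2) ≤ vecNorm (fields n) p v := by
  rw [vecNorm, Real.sqrt_eq_rpow, ← ENNReal.ofReal_rpow_of_nonneg (by positivity) (by norm_num)]
  gcongr
  refine le_iInf₂ fun α hα => ENNReal.ofReal_le_ofReal ?_
  rw [sum_fields] at hα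
  rw [Fintype.sum_sum_type]
  have h2 : v.2 = inner ℝ (WithLp.toLp 2 fun j => α (Sum.inr j)) p.1 := by
    simp [hα, PiLp.inner_apply, mul_comm]
  have h3 := abs_real_inner_le_norm (WithLp.toLp 2 fun j => α (Sum.inr j)) p.1
  rw [← h2] at h3
  refine add_le_add ?_ ?_
  · rw [hα, EuclideanSpace.norm_sq_eq]; simp
  · have h4 : v.2 ^ 2 ≤ (∑ j, α (Sum.inr j) ^ 2) * ‖p.1‖ ^ 2 := by
      calc v.2 ^ 2 = |v.2| ^ 2 := (sq_abs _).symm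
        _ ≤ (‖WithLp.toLp 2 fun j => α (Sum.inr j)‖ * ‖p.1‖) ^ 2 := by gcongr
        _ = _ := by rw [mul_pow, EuclideanSpace.norm_sq_eq]; simp
    exact div_le_of_le_mul₀ (by positivity) (by positivity) h4

/-- The multiple of `p.1` is the control of least norm. Tangency matters only at `p.1 = 0`, where it
forces `v.2 = 0`. -/
theorem snd_eq_inner_of_mem_span {p v : Space n}
    (h : v ∈ Submodule.span ℝ (range fun j => fields n j p)) :
    v.2 = inner ℝ ((v.2 / ‖p.1‖ ^ 2) • p.1) p.1 := by
  obtain ⟨β, hβ⟩ := mem_span_fields_iff.1 h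
  rw [real_inner_smul_left, real_inner_self_eq_norm_sq]
  by_cases hp : p.1 = 0
  · simp [hβ, hp]
  · have : ‖p.1‖ ≠ 0 := norm_ne_zero_iff.2 hp
    field_simp

theorem norm_control_sq (p v : Space n) :
    ‖(v.2 / ‖p.1‖ ^ 2) • p.1‖ ^ 2 = v.2 ^ 2 / ‖p.1‖ ^ 2 := by
  by_cases hp : p.1 = 0
  · simp [hp]
  · have : ‖p.1‖ ≠ 0 := norm_ne_zero_iff.2 hp
    rw [norm_smul, mul_pow, Real.norm_eq_abs, sq_abs]
    field_simp

theorem vecNorm_fields_eq {p v : Space n}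
    (h : v ∈ Submodule.span ℝ (range fun j => fields n j p)) :
    vecNorm (fields n) p v = ENNReal.ofReal √(‖v.1‖ ^ 2 + v.2 ^ 2 / ‖p.1‖ ^ 2) := by
  refine le_antisymm ?_ (le_vecNorm_fields p v)
  rw [← norm_control_sq p v]
  exact vecNorm_fields_le _ (snd_eq_inner_of_mem_span h)

end VecNorm

/-! ### Absolutely continuous functions and the fundamental theorem of calculus -/

section AbsolutelyContinuous

variable {X Y : Type*} [PseudoMetricSpace X] [PseudoMetricSpace Y] {a b : ℝ}

theorem absolutelyContinuous_congr {f g : ℝ → X} (hf : AbsolutelyContinuousOnInterval f a b)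
    (h : EqOn f g (uIcc a b)) : AbsolutelyContinuousOnInterval g a b := by
  rw [absolutelyContinuousOnInterval_iff] at hf ⊢
  intro ε hε
  obtain ⟨δ, hδ, H⟩ := hf ε hε
  refine ⟨δ, hδ, fun E hE hl => ?_⟩
  convert! H E hE hl using 1
  refine Finset.sum_congr rfl fun i hi => ?_
  rw [h (hE.1 i hi).1, h (hE.1 i hi).2]

theorem absolutelyContinuous_comp {f : ℝ → X} {φ : X → Y} {s : Set X} {K : ℝ≥0}
    (hf : AbsolutelyContinuousOnInterval f a b) (hφ : LipschitzOnWith K φ s)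
    (hs : MapsTo f (uIcc a b) s) : AbsolutelyContinuousOnInterval (fun t => φ (f t)) a b := by
  rw [absolutelyContinuousOnInterval_iff] at hf ⊢
  intro ε hε
  obtain ⟨δ, hδ, H⟩ := hf (ε / (K + 1)) (by positivity)
  refine ⟨δ, hδ, fun E hE hl => ?_⟩
  calc ∑ i ∈ Finset.range E.1, dist (φ (f (E.2 i).1)) (φ (f (E.2 i).2))
      ≤ ∑ i ∈ Finset.range E.1, (K + 1) * dist (f (E.2 i).1) (f (E.2 i).2) := by
        refine Finset.sum_le_sum fun i hi => ?_
        refine (hφ.dist_le_mul _ (hs (hE.1 i hi).1) _ (hs (hE.1 i hi).2)).trans ?_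
        gcongr
        linarith
    _ = (K + 1) * ∑ i ∈ Finset.range E.1, dist (f (E.2 i).1) (f (E.2 i).2) := by
        rw [Finset.mul_sum]
    _ < (K + 1) * (ε / (K + 1)) := by
        gcongr
        exact H E hE hl
    _ = ε := by field_simp

theorem absolutelyContinuous_sum {ι : Type*} (s : Finset ι) {f : ι → ℝ → ℝ}
    (hf : ∀ i ∈ s, AbsolutelyContinuousOnInterval (f i) a b) :
    AbsolutelyContinuousOnInterval (fun t => ∑ i ∈ s, f i t) a b := by
  classical
  induction s using Finset.induction_on with
  | empty =>
    simpa using (LipschitzWith.const (0 : ℝ)).lipschitzOnWith.absolutelyContinuousOnInterval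
      (a := a) (b := b)
  | insert i s hi ih =>
    simp only [Finset.sum_insert hi]
    exact (hf i (Finset.mem_insert_self _ _)).fun_add
      (ih fun j hj => hf j (Finset.mem_insert_of_mem hj))

theorem absolutelyContinuous_coord {n : ℕ} {f : ℝ → EuclideanSpace ℝ (Fin n)}
    (hf : AbsolutelyContinuousOnInterval f a b) (i : Fin n) :
    AbsolutelyContinuousOnInterval (fun t => f t i) a b := by
  -- Absolute continuity is by definition a limit statement for the sums of distances, so comparing
  -- the sums suffices.
  refine squeeze_zero (fun _ => Finset.sum_nonneg fun _ _ => dist_nonneg) (fun E => ?_) hf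
  refine Finset.sum_le_sum fun j _ => ?_
  simp only [dist_eq_norm]
  exact PiLp.norm_apply_le (f (E.2 j).1 - f (E.2 j).2) i

theorem absolutelyContinuous_inner {n : ℕ} {f g : ℝ → EuclideanSpace ℝ (Fin n)}
    (hf : AbsolutelyContinuousOnInterval f a b) (hg : AbsolutelyContinuousOnInterval g a b) :
    AbsolutelyContinuousOnInterval (fun t => inner ℝ (f t) (g t)) a b := by
  have h := absolutelyContinuous_sum Finset.univ fun i _ =>
    (absolutelyContinuous_coord hf i).fun_mul (absolutelyContinuous_coord hg i)
  refine absolutelyContinuous_congr h fun t _ => ?_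
  simp [PiLp.inner_apply, mul_comm]

theorem integral_eq_sub_of_absolutelyContinuous {f f' : ℝ → ℝ} (hab : a ≤ b)
    (hf : AbsolutelyContinuousOnInterval f a b)
    (h : ∀ᵐ t, t ∈ Icc a b → HasDerivAt f (f' t) t) :
    IntervalIntegrable f' volume a b ∧ ∫ t in a..b, f' t = f b - f a := by
  have h' : ∀ᵐ t, t ∈ uIoc a b → deriv f t = f' t := by
    filter_upwards [h] with t ht hm
    rw [uIoc_of_le hab] at hm
    exact (ht (Ioc_subset_Icc_self hm)).deriv
  refine ⟨hf.intervalIntegrable_deriv.congr_ae ?_, ?_⟩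
  · rwa [Filter.EventuallyEq, ae_restrict_iff' measurableSet_uIoc]
  · rw [← hf.integral_deriv_eq_sub]
    refine intervalIntegral.integral_congr_ae ?_
    filter_upwards [h'] with t ht hm using (ht hm).symm

theorem lipschitzOnWith_primitive {E : Type*} [NormedAddCommGroup E] [NormedSpace ℝ E]
    {f : ℝ → E} {K : ℝ≥0} (hint : ∀ s ∈ Icc a b, IntervalIntegrable f volume a s)
    (hf : ∀ t ∈ Icc a b, ‖f t‖ ≤ K) :
    LipschitzOnWith K (fun t => ∫ s in a..t, f s) (Icc a b) := by
  refine LipschitzOnWith.of_dist_le_mul fun x hx y hy => ?_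
  rw [dist_eq_norm, intervalIntegral.integral_interval_sub_left (hint x hx) (hint y hy),
    Real.dist_eq]
  refine intervalIntegral.norm_integral_le_of_norm_le_const fun t ht => hf t ?_
  have := uIoc_subset_uIcc.trans (uIcc_subset_Icc hy hx) ht
  exact this

end AbsolutelyContinuous

/-! ### Upper bounds for the distance from measurable controls -/

section Competitors

variable {n : ℕ}

theorem integrableOn_of_measurable_bounded {E : Type*} [NormedAddCommGroup E]
    {f : ℝ → E} {K : ℝ} (hf : StronglyMeasurable f) (hb : ∀ t, ‖f t‖ ≤ K) (a b : ℝ) :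
    IntervalIntegrable f volume a b := by
  refine intervalIntegrable_iff.2 (Measure.integrableOn_of_bounded (M := K) ?_
    hf.aestronglyMeasurable (Filter.Eventually.of_forall hb))
  simp [uIoc]

/-- Integrate `(√f - m)² ≥ 0` with `m` the mean of `√f`. This bounds length by energy, which is
quadratic in the controls and hence easier to vary. -/
theorem integral_sqrt_le_sqrt_integral {f : ℝ → ℝ} (hf : ∀ t, 0 ≤ f t)
    (hi : IntervalIntegrable f volume 0 1) (hs : IntervalIntegrable (fun t => √(f t)) volume 0 1) :
    ∫ t in (0 : ℝ)..1, √(f t) ≤ √(∫ t in (0 : ℝ)..1, f t) := by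
  set m := ∫ t in (0 : ℝ)..1, √(f t) with hm
  have h0 : 0 ≤ ∫ t in (0 : ℝ)..1, (f t - 2 * m * √(f t) + m ^ 2) := by
    refine intervalIntegral.integral_nonneg zero_le_one fun t _ => ?_
    have := Real.sq_sqrt (hf t)
    nlinarith [sq_nonneg (√(f t) - m)]
  rw [intervalIntegral.integral_add (hi.sub (hs.const_mul _)) (by simp),
    intervalIntegral.integral_sub hi (hs.const_mul _), intervalIntegral.integral_const_mul,
    ← hm] at h0
  simp at h0
  exact Real.le_sqrt_of_sq_le (by nlinarith)

theorem intervalIntegrable_inner_of_bounded {β x : ℝ → EuclideanSpace ℝ (Fin n)} {K : ℝ}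
    (hβ : StronglyMeasurable β) (hβK : ∀ t, ‖β t‖ ≤ K) (hx : Continuous x) (a b : ℝ) :
    IntervalIntegrable (fun t => (inner ℝ (β t) (x t) : ℝ)) volume a b := by
  have hK : 0 ≤ K := (norm_nonneg _).trans (hβK 0)
  obtain ⟨D, hD⟩ := isCompact_uIcc.exists_bound_of_continuousOn (s := uIcc a b) hx.continuousOn
  refine intervalIntegrable_iff.2 (Measure.integrableOn_of_bounded (M := K * D) (by simp [uIoc])
    (hβ.inner hx.stronglyMeasurable).aestronglyMeasurable ?_)
  filter_upwards [ae_restrict_mem measurableSet_uIoc] with t ht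
  exact (norm_inner_le_norm _ _).trans
    (mul_le_mul (hβK t) (hD t (uIoc_subset_uIcc ht)) (norm_nonneg _) hK)

/-- The curve driven by the controls `α`, `β` on `[0, 1]` bounds the distance of its end points. -/
theorem dCC_le_of_controls_unit {α β : ℝ → EuclideanSpace ℝ (Fin n)} {K : ℝ}
    (hα : StronglyMeasurable α) (hβ : StronglyMeasurable β)
    (hαK : ∀ t, ‖α t‖ ≤ K) (hβK : ∀ t, ‖β t‖ ≤ K) (x : ℝ → EuclideanSpace ℝ (Fin n))
    (hx : ∀ t, x t = x 0 + ∫ s in (0 : ℝ)..t, α s) (u₀ : ℝ) :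
    dCC (fields n) (x 0, u₀) (x 1, u₀ + ∫ t in (0 : ℝ)..1, inner ℝ (β t) (x t)) ≤
      ENNReal.ofReal √(∫ t in (0 : ℝ)..1, ‖α t‖ ^ 2 + ‖β t‖ ^ 2) := by
  have hK : 0 ≤ K := (norm_nonneg _).trans (hαK 0)
  have hαi := integrableOn_of_measurable_bounded hα hαK
  have hxc : Continuous x := by
    rw [show x = fun t => x 0 + ∫ s in (0 : ℝ)..t, α s from funext hx]
    exact continuous_const.add (intervalIntegral.continuous_primitive hαi 0)
  have hβx : StronglyMeasurable fun t => inner ℝ (β t) (x t) := hβ.inner hxc.stronglyMeasurable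
  obtain ⟨D, hD⟩ := isCompact_Icc.exists_bound_of_continuousOn (s := Icc (0 : ℝ) 1) hxc.continuousOn
  have hD0 : 0 ≤ D := (norm_nonneg _).trans (hD 0 (by simp))
  have hβxD : ∀ t ∈ Icc (0 : ℝ) 1, ‖(inner ℝ (β t) (x t) : ℝ)‖ ≤ (⟨K * D, by positivity⟩ : ℝ≥0) := by
    intro t ht
    calc ‖(inner ℝ (β t) (x t) : ℝ)‖ ≤ ‖β t‖ * ‖x t‖ := norm_inner_le_norm _ _
      _ ≤ K * D := mul_le_mul (hβK t) (hD t ht) (norm_nonneg _) hK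
  have hβxi (a b : ℝ) := intervalIntegrable_inner_of_bounded hβ hβK hxc a b
  set y : ℝ → Space n := fun t => (x t, u₀ + ∫ s in (0 : ℝ)..t, inner ℝ (β s) (x s)) with hy
  have hder : ∀ᵐ t, t ∈ Icc (0 : ℝ) 1 → HasDerivAt y (α t, inner ℝ (β t) (x t)) t := by
    filter_upwards [(hαi 0 1).ae_hasDerivAt_integral, (hβxi 0 1).ae_hasDerivAt_integral]
      with t h1 h2 ht
    rw [← uIcc_of_le zero_le_one] at ht
    refine HasDerivAt.prodMk ?_ ((h2 ht 0 (by simp)).const_add _)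
    rw [show x = fun t => x 0 + ∫ s in (0 : ℝ)..t, α s from funext hx]
    exact (h1 ht 0 (by simp)).const_add _
  have hhor : IsHorizontal (fields n) y := by
    constructor
    · have h1 := lipschitzOnWith_primitive (a := 0) (b := 1) (K := ⟨K, hK⟩)
        (fun s _ => hαi 0 s) fun t _ => hαK t
      have h2 := lipschitzOnWith_primitive (a := 0) (b := 1) (fun s _ => hβxi 0 s) hβxD
      have h3 := h1.prodMk h2
      rw [← uIcc_of_le zero_le_one] at h3
      have h4 := ((LipschitzWith.const (α := ℝ) ((x 0, u₀) : Space n)).lipschitzOnWith (s := uIcc (0 : ℝ) 1)).absolutelyContinuousOnInterval.fun_add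
        h3.absolutelyContinuousOnInterval
      refine absolutelyContinuous_congr h4 fun t _ => ?_
      simp [hy, ← hx]
    · rw [ae_restrict_iff' measurableSet_Icc]
      filter_upwards [hder] with t h ht
      rw [(h ht).deriv]
      exact mem_span_fields_iff.2 ⟨β t, rfl⟩
  have hsm : StronglyMeasurable fun t => ‖α t‖ ^ 2 + ‖β t‖ ^ 2 :=
    (hα.norm.pow 2).add (hβ.norm.pow 2)
  have hsb (t : ℝ) : ‖α t‖ ^ 2 + ‖β t‖ ^ 2 ≤ K ^ 2 + K ^ 2 := by
    gcongr
    exacts [hαK t, hβK t]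
  have hi2 : IntervalIntegrable (fun t => ‖α t‖ ^ 2 + ‖β t‖ ^ 2) volume 0 1 := by
    refine integrableOn_of_measurable_bounded (K := K ^ 2 + K ^ 2)
      hsm (fun t => ?_) 0 1
    rw [Real.norm_of_nonneg (by positivity)]
    exact hsb t
  have hi1 : IntervalIntegrable (fun t => √(‖α t‖ ^ 2 + ‖β t‖ ^ 2)) volume 0 1 := by
    refine integrableOn_of_measurable_bounded (K := √(K ^ 2 + K ^ 2))
      (Real.continuous_sqrt.comp_stronglyMeasurable hsm)
      (fun t => ?_) 0 1
    rw [Real.norm_of_nonneg (Real.sqrt_nonneg _)]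
    exact Real.sqrt_le_sqrt (hsb t)
  have hlen : length (fields n) y ≤ ENNReal.ofReal √(∫ t in (0 : ℝ)..1, ‖α t‖ ^ 2 + ‖β t‖ ^ 2) := by
    calc length (fields n) y
        ≤ ∫⁻ t in Icc (0 : ℝ) 1, ENNReal.ofReal √(‖α t‖ ^ 2 + ‖β t‖ ^ 2) := by
          refine lintegral_mono_ae ?_
          rw [ae_restrict_iff' measurableSet_Icc]
          filter_upwards [hder] with t h ht
          rw [(h ht).deriv]
          exact vecNorm_fields_le (β t) rfl
      _ = ENNReal.ofReal (∫ t in (0 : ℝ)..1, √(‖α t‖ ^ 2 + ‖β t‖ ^ 2)) := by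
          rw [intervalIntegral.integral_of_le zero_le_one, ← integral_Icc_eq_integral_Ioc,
            ofReal_integral_eq_lintegral_ofReal]
          · rw [IntegrableOn.eq_1 .. |>.symm, integrableOn_Icc_iff_integrableOn_Ioc]
            exact (intervalIntegrable_iff_integrableOn_Ioc_of_le zero_le_one).1 hi1
          · exact Filter.Eventually.of_forall fun t => Real.sqrt_nonneg _
      _ ≤ _ := ENNReal.ofReal_le_ofReal
          (integral_sqrt_le_sqrt_integral (fun t => by positivity) hi2 hi1)
  refine (iInf₂_le_of_le y ⟨hhor, ?_, ?_⟩ hlen)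
  · simp [hy]
  · simp [hy]

/-- Affine reparametrization of `[r, s]` by `[0, 1]` multiplies the controls by `s - r`; this is the
origin of the factor in front of the energy. -/
theorem dCC_le_of_controls {α β : ℝ → EuclideanSpace ℝ (Fin n)} {K r s : ℝ} (hrs : r < s)
    (hα : StronglyMeasurable α) (hβ : StronglyMeasurable β)
    (hαK : ∀ t, ‖α t‖ ≤ K) (hβK : ∀ t, ‖β t‖ ≤ K) (x : ℝ → EuclideanSpace ℝ (Fin n))
    (hx : ∀ t, x t = x r + ∫ s in r..t, α s) (u₀ : ℝ) :
    dCC (fields n) (x r, u₀) (x s, u₀ + ∫ t in r..s, inner ℝ (β t) (x t)) ≤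
      ENNReal.ofReal √((s - r) * ∫ t in r..s, ‖α t‖ ^ 2 + ‖β t‖ ^ 2) := by
  have hl : 0 < s - r := sub_pos.2 hrs
  have hφ : Continuous fun t : ℝ => (s - r) * t + r := by fun_prop
  have hb {f : ℝ → EuclideanSpace ℝ (Fin n)} (hf : ∀ t, ‖f t‖ ≤ K) (t : ℝ) :
      ‖(s - r) • f ((s - r) * t + r)‖ ≤ (s - r) * K := by
    rw [norm_smul, Real.norm_of_nonneg hl.le]
    gcongr
    exact hf _
  have h := dCC_le_of_controls_unit (α := fun t => (s - r) • α ((s - r) * t + r))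
    (β := fun t => (s - r) • β ((s - r) * t + r))
    ((hα.comp_measurable hφ.measurable).const_smul (s - r))
    ((hβ.comp_measurable hφ.measurable).const_smul (s - r))
    (hb hαK) (hb hβK) (fun t => x ((s - r) * t + r)) (fun t => by
      rw [intervalIntegral.integral_smul, intervalIntegral.smul_integral_comp_mul_add]
      simpa using hx _) u₀
  convert h using 2
  · simp
  · congr 1
    · simp
    · simp only [real_inner_smul_left]
      rw [intervalIntegral.integral_const_mul, intervalIntegral.mul_integral_comp_mul_add
        (f := fun t => inner ℝ (β t) (x t))]
      simp
  · simp only [norm_smul, mul_pow, ← mul_add, Real.norm_of_nonneg hl.le]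
    rw [intervalIntegral.integral_const_mul, sq, mul_assoc,
      intervalIntegral.mul_integral_comp_mul_add (f := fun t => ‖α t‖ ^ 2 + ‖β t‖ ^ 2)]
    simp

theorem dCC_self (p : Space n) : dCC (fields n) p p = 0 := by
  have h := dCC_le_of_controls_unit (n := n) (α := 0) (β := 0) (K := 0) stronglyMeasurable_zero
    stronglyMeasurable_zero (by simp) (by simp) (fun _ => p.1) (by simp) p.2
  simpa using h

end Competitors

/-! ### The calibration inequality -/

section Calibration

variable {n : ℕ}

/-- The sub-Riemannian norm of the tangent vector `v` at `p`, as a real number, for tangent `v`. -/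
noncomputable def speed (p v : Space n) : ℝ :=
  √(‖v.1‖ ^ 2 + v.2 ^ 2 / ‖p.1‖ ^ 2)

theorem speed_nonneg (p v : Space n) : 0 ≤ speed p v := Real.sqrt_nonneg _

theorem IsHorizontal.ae_vecNorm_eq {γ : ℝ → Space n} (hγ : IsHorizontal (fields n) γ) :
    ∀ᵐ t ∂(volume.restrict (Icc (0 : ℝ) 1)),
      vecNorm (fields n) (γ t) (deriv γ t) = ENNReal.ofReal (speed (γ t) (deriv γ t)) := by
  filter_upwards [hγ.tangent] with t ht using vecNorm_fields_eq ht

theorem IsHorizontal.aestronglyMeasurable_speed {γ : ℝ → Space n}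
    (hγ : IsHorizontal (fields n) γ) :
    AEStronglyMeasurable (fun t => speed (γ t) (deriv γ t)) (volume.restrict (Icc (0 : ℝ) 1)) := by
  have h1 : AEMeasurable γ (volume.restrict (Icc (0 : ℝ) 1)) := by
    have := hγ.ac.continuousOn
    rw [uIcc_of_le zero_le_one] at this
    exact this.aemeasurable measurableSet_Icc
  have h2 : Measurable (deriv γ) := measurable_deriv γ
  have h3 : AEMeasurable (fun t => speed (γ t) (deriv γ t)) (volume.restrict (Icc (0 : ℝ) 1)) := by
    unfold speed
    exact (((h2.fst.norm.pow_const 2).aemeasurable).add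
      ((h2.snd.pow_const 2).aemeasurable.div (h1.fst.norm.pow_const 2))).sqrt
  exact h3.aestronglyMeasurable

theorem IsHorizontal.integrable_speed {γ : ℝ → Space n} (hγ : IsHorizontal (fields n) γ)
    (h : length (fields n) γ ≠ ∞) :
    IntervalIntegrable (fun t => speed (γ t) (deriv γ t)) volume 0 1 ∧
      length (fields n) γ = ENNReal.ofReal (∫ t in (0 : ℝ)..1, speed (γ t) (deriv γ t)) := by
  have h1 : length (fields n) γ =
      ∫⁻ t in Icc (0 : ℝ) 1, ENNReal.ofReal (speed (γ t) (deriv γ t)) :=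
    lintegral_congr_ae hγ.ae_vecNorm_eq
  have h2 : IntegrableOn (fun t => speed (γ t) (deriv γ t)) (Icc 0 1) := by
    refine ⟨hγ.aestronglyMeasurable_speed, ?_⟩
    rw [hasFiniteIntegral_iff_ofReal (Filter.Eventually.of_forall fun t => speed_nonneg _ _), ← h1]
    exact h.lt_top
  refine ⟨?_, ?_⟩
  · rw [intervalIntegrable_iff_integrableOn_Ioc_of_le zero_le_one]
    exact h2.mono_set Ioc_subset_Icc_self
  · rw [h1, intervalIntegral.integral_of_le zero_le_one, ← integral_Icc_eq_integral_Ioc,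
      ofReal_integral_eq_lintegral_ofReal h2
        (Filter.Eventually.of_forall fun t => speed_nonneg _ _)]

theorem exists_lipschitzOnWith_of_hasDerivAt {f f' : ℝ → ℝ} {r s : ℝ}
    (hf : ∀ t ∈ Icc r s, HasDerivAt f (f' t) t) (hf' : ContinuousOn f' (Icc r s)) :
    ∃ K, LipschitzOnWith K f (Icc r s) := by
  obtain ⟨K, hK⟩ := isCompact_Icc.exists_bound_of_continuousOn hf'
  refine ⟨K.toNNReal, (convex_Icc r s).lipschitzOnWith_of_nnnorm_hasDerivWithin_le
    (fun t ht => (hf t ht).hasDerivWithinAt) fun t ht => ?_⟩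
  rw [← NNReal.coe_le_coe, coe_nnnorm]
  exact (hK t ht).trans (Real.le_coe_toNNReal K)

/-- Young's inequality between the covector `(g, b ‖x‖)` and the velocity `(‖ξ‖, |η| / ‖x‖)`, whose
norm is at most `σ`. The hypothesis `hx` excludes the spurious value `η ^ 2 / 0 = 0`. Applied with
`g = ∂ₓS`, it bounds the derivative of `S` along the curve. -/
theorem mul_add_inner_le {x ξ g : EuclideanSpace ℝ (Fin n)} {b η κ σ : ℝ} (hκ : 0 < κ) (hσ : 0 < σ)
    (h : √(‖ξ‖ ^ 2 + η ^ 2 / ‖x‖ ^ 2) ≤ σ) (hx : x = 0 → η = 0) :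
    b * η + inner ℝ g ξ - κ * σ / 2 * (‖g‖ ^ 2 + b ^ 2 * ‖x‖ ^ 2) ≤ σ / (2 * κ) := by
  have h1 : ‖ξ‖ ^ 2 + (|η| / ‖x‖) ^ 2 ≤ σ ^ 2 := by
    rw [div_pow, sq_abs]
    exact (Real.sqrt_le_left hσ.le).1 h
  have h2 : b * η ≤ (|b| * ‖x‖) * (|η| / ‖x‖) := by
    by_cases h0 : x = 0
    · simp [h0, hx h0]
    · have : ‖x‖ ≠ 0 := norm_ne_zero_iff.2 h0
      have e : (|b| * ‖x‖) * (|η| / ‖x‖) = |b * η| := by rw [abs_mul]; field_simp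
      exact e ▸ le_abs_self _
  have h3 : inner ℝ g ξ ≤ ‖g‖ * ‖ξ‖ := real_inner_le_norm g ξ
  have h4 : b ^ 2 * ‖x‖ ^ 2 = (|b| * ‖x‖) ^ 2 := by rw [mul_pow, sq_abs]
  rw [h4]
  generalize |b| * ‖x‖ = B at *
  generalize |η| / ‖x‖ = H at *
  rw [le_div_iff₀ (by positivity)]
  have h5 : σ * ((‖g‖ * ‖ξ‖ + B * H - κ * σ / 2 * (‖g‖ ^ 2 + B ^ 2)) * (2 * κ)) ≤ σ * σ := by
    nlinarith [sq_nonneg (κ * σ * ‖g‖ - ‖ξ‖), sq_nonneg (κ * σ * B - H)]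
  have h6 := le_of_mul_le_mul_left h5 hσ
  refine le_trans ?_ h6
  exact mul_le_mul_of_nonneg_right (by linarith) (by positivity)

/-- Calibration by the time dependent function
`S(t, (x, u)) = b u + a(t) ‖x‖² / 2 + q(t) ⟨w, x⟩ + d(t)`, a solution of the Hamilton–Jacobi
equation. -/
theorem IsHorizontal.calibration {γ : ℝ → Space n} (hγ : IsHorizontal (fields n) γ) {M : ℝ}
    (hM : length (fields n) γ < ENNReal.ofReal M) {b r s : ℝ} (hrs : r < s) {a q d : ℝ → ℝ}
    {w : EuclideanSpace ℝ (Fin n)}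
    (ha : ∀ t ∈ Icc r s, HasDerivAt a (-(a t ^ 2 + b ^ 2)) t)
    (hq : ∀ t ∈ Icc r s, HasDerivAt q (-(a t * q t)) t)
    (hd : ∀ t ∈ Icc r s, HasDerivAt d (-(q t ^ 2 * ‖w‖ ^ 2 / 2)) t) :
    (b * (γ 1).2 + a s / 2 * ‖(γ 1).1‖ ^ 2 + q s * inner ℝ w (γ 1).1 + d s) -
      (b * (γ 0).2 + a r / 2 * ‖(γ 0).1‖ ^ 2 + q r * inner ℝ w (γ 0).1 + d r) ≤
      M ^ 2 / (2 * (s - r)) := by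
  obtain ⟨hvi, hL⟩ := hγ.integrable_speed hM.ne_top
  set v : ℝ → ℝ := fun t => speed (γ t) (deriv γ t) with hv
  set L := ∫ t in (0 : ℝ)..1, v t with hLdef
  have hL0 : 0 ≤ L := intervalIntegral.integral_nonneg zero_le_one fun t _ => speed_nonneg _ _
  rw [hL, ENNReal.ofReal_lt_ofReal_iff_of_nonneg hL0] at hM
  have hM0 : 0 < M := hL0.trans_lt hM
  have hrs' : 0 < s - r := sub_pos.2 hrs
  set κ := (s - r) / M with hκ
  have hκ0 : 0 < κ := by positivity
  -- A padded speed: strictly positive even where the curve rests, and with integral exactly `M`.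
  set σ : ℝ → ℝ := fun t => v t + (M - L) with hσ
  have hσ0 (t : ℝ) : 0 < σ t := by
    have := speed_nonneg (γ t) (deriv γ t)
    simp only [hσ, hv]; linarith
  have hσi : IntervalIntegrable σ volume 0 1 := hvi.add (by simp)
  have hσ1 : ∫ t in (0 : ℝ)..1, σ t = M := by
    rw [hσ, intervalIntegral.integral_add hvi (by simp)]
    simp [← hLdef]
  -- Instead of reparametrizing `γ` by arc length, the time argument of `S` is made to advance in
  -- proportion to `σ`, from `r` to `s`.
  set τ : ℝ → ℝ := fun t => r + κ * ∫ t' in (0 : ℝ)..t, σ t' with hτ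
  have hτ0 : τ 0 = r := by simp [hτ]
  have hτ1 : τ 1 = s := by
    simp only [hτ, hσ1, hκ]; field_simp; ring
  have hcr : LipschitzWith 0 fun _ : ℝ => r := LipschitzWith.const r
  have hτac : AbsolutelyContinuousOnInterval τ 0 1 :=
    (hcr.lipschitzOnWith.absolutelyContinuousOnInterval).fun_add
      ((hσi.absolutelyContinuousOnInterval_intervalIntegral (c := 0) (by simp)).const_mul κ)
  have hσsub {x y : ℝ} (hx : x ∈ Icc (0 : ℝ) 1) (hy : y ∈ Icc (0 : ℝ) 1) :
      IntervalIntegrable σ volume x y :=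
    hσi.mono_set (uIcc_subset_uIcc (by rwa [uIcc_of_le zero_le_one])
      (by rwa [uIcc_of_le zero_le_one]))
  have hτm : MapsTo τ (uIcc 0 1) (Icc r s) := by
    intro t ht
    rw [uIcc_of_le zero_le_one] at ht
    have h1 : 0 ≤ ∫ t' in (0 : ℝ)..t, σ t' :=
      intervalIntegral.integral_nonneg ht.1 fun t' _ => (hσ0 t').le
    have h2 : 0 ≤ ∫ t' in t..1, σ t' :=
      intervalIntegral.integral_nonneg ht.2 fun t' _ => (hσ0 t').le
    have h3 := intervalIntegral.integral_add_adjacent_intervals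
      (hσsub (x := 0) (by simp) ht) (hσsub (y := 1) ht (by simp))
    refine ⟨?_, ?_⟩
    · simp only [hτ]; nlinarith
    · rw [← hτ1]
      simp only [hτ]; rw [← h3]; nlinarith
  have hac : ContinuousOn a (Icc r s) := fun t ht => (ha t ht).continuousAt.continuousWithinAt
  have hqc : ContinuousOn q (Icc r s) := fun t ht => (hq t ht).continuousAt.continuousWithinAt
  obtain ⟨Ka, hKa⟩ := exists_lipschitzOnWith_of_hasDerivAt ha (by fun_prop)
  obtain ⟨Kq, hKq⟩ := exists_lipschitzOnWith_of_hasDerivAt hq (by fun_prop)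
  obtain ⟨Kd, hKd⟩ := exists_lipschitzOnWith_of_hasDerivAt hd (by fun_prop)
  have hxac : AbsolutelyContinuousOnInterval (fun t => (γ t).1) 0 1 :=
    absolutelyContinuous_comp hγ.ac LipschitzWith.prod_fst.lipschitzOnWith (mapsTo_univ _ _)
  have huac : AbsolutelyContinuousOnInterval (fun t => (γ t).2) 0 1 :=
    absolutelyContinuous_comp hγ.ac LipschitzWith.prod_snd.lipschitzOnWith (mapsTo_univ _ _)
  have hwac : AbsolutelyContinuousOnInterval (fun _ => w) 0 1 :=
    (LipschitzWith.const w).lipschitzOnWith.absolutelyContinuousOnInterval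
  set Φ : ℝ → ℝ := fun t => b * (γ t).2 + (1 / 2) * (a (τ t) * inner ℝ (γ t).1 (γ t).1) +
    q (τ t) * inner ℝ w (γ t).1 + d (τ t) with hΦ
  have hΦac : AbsolutelyContinuousOnInterval Φ 0 1 :=
    (((huac.const_mul b).fun_add (((absolutelyContinuous_comp hτac hKa hτm).fun_mul
      (absolutelyContinuous_inner hxac hxac)).const_mul (1 / 2))).fun_add
      ((absolutelyContinuous_comp hτac hKq hτm).fun_mul
        (absolutelyContinuous_inner hwac hxac))).fun_add (absolutelyContinuous_comp hτac hKd hτm)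
  set Φ' : ℝ → ℝ := fun t =>
    b * (deriv γ t).2 + inner ℝ (a (τ t) • (γ t).1 + q (τ t) • w) (deriv γ t).1 -
      κ * σ t / 2 * (‖a (τ t) • (γ t).1 + q (τ t) • w‖ ^ 2 + b ^ 2 * ‖(γ t).1‖ ^ 2) with hΦ'
  have hdiff : ∀ᵐ t, t ∈ Icc (0 : ℝ) 1 → DifferentiableAt ℝ γ t := by
    have := hγ.ac.boundedVariationOn.ae_differentiableAt_of_mem_uIcc
    rwa [uIcc_of_le zero_le_one] at this
  have hder : ∀ᵐ t, t ∈ Icc (0 : ℝ) 1 → HasDerivAt Φ (Φ' t) t := by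
    filter_upwards [hdiff, hσi.ae_hasDerivAt_integral] with t h1 h2 ht
    have hγt := (h1 ht).hasDerivAt
    have ht' : t ∈ uIcc (0 : ℝ) 1 := by rwa [uIcc_of_le zero_le_one]
    have hτt : HasDerivAt τ (κ * σ t) t := ((h2 ht' 0 (by simp)).const_mul κ).const_add r
    have hx : HasDerivAt (fun t => (γ t).1) (deriv γ t).1 t := hγt.fst
    have hu : HasDerivAt (fun t => (γ t).2) (deriv γ t).2 t := hγt.snd
    have hat := (ha _ (hτm ht')).comp t hτt
    have hqt := (hq _ (hτm ht')).comp t hτt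
    have hdt := (hd _ (hτm ht')).comp t hτt
    have hall := (((hu.const_mul b).add ((hat.mul (hx.inner ℝ hx)).const_mul (1 / 2))).add
      (hqt.mul ((hasDerivAt_const t w).inner ℝ hx))).add hdt
    refine hall.congr_deriv ?_
    simp only [hΦ', Function.comp_apply, ← real_inner_self_eq_norm_sq, inner_add_left,
      inner_add_right, real_inner_smul_left, real_inner_smul_right, inner_zero_left,
      real_inner_comm (γ t).1 w, real_inner_comm (γ t).1 (deriv γ t).1]
    ring
  obtain ⟨hΦi, hΦint⟩ := integral_eq_sub_of_absolutelyContinuous zero_le_one hΦac hder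
  have hle : ∫ t in (0 : ℝ)..1, Φ' t ≤ ∫ t in (0 : ℝ)..1, σ t / (2 * κ) := by
    refine intervalIntegral.integral_mono_ae_restrict zero_le_one hΦi (hσi.div_const _) ?_
    filter_upwards [hγ.tangent] with t ht
    refine mul_add_inner_le hκ0 (hσ0 t) ?_ fun h0 => ?_
    · simp only [hσ, hv, speed]; linarith
    · have := snd_eq_inner_of_mem_span ht
      rw [this, h0]; simp
  rw [intervalIntegral.integral_div, hσ1, hΦint] at hle
  have e : M / (2 * κ) = M ^ 2 / (2 * (s - r)) := by rw [hκ]; field_simp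
  rw [e] at hle
  refine le_trans (le_of_eq ?_) hle
  simp only [hΦ, hτ0, hτ1, real_inner_self_eq_norm_sq]
  ring

end Calibration

/-! ### The explicit curves are geodesics -/

section ExplicitCurves

variable {n : ℕ}

theorem curve_zero_eq {b : ℝ} (hb : b ≠ 0) (c : EuclideanSpace ℝ (Fin n)) (t : ℝ) :
    curve 0 0 b c t =
      ((Real.sin (b * t) / b) • c, ‖c‖ ^ 2 / b * (t / 2 - Real.sin (2 * b * t) / (4 * b))) := by
  simp [curve, hb]

theorem hasDerivAt_sin_mul_div {b : ℝ} (hb : b ≠ 0) (t : ℝ) :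
    HasDerivAt (fun t => Real.sin (b * t) / b) (Real.cos (b * t)) t := by
  have h := ((((hasDerivAt_id t).const_mul b).sin).div_const b)
  refine h.congr_deriv ?_
  simp only [id]; field_simp

theorem hasDerivAt_height {b : ℝ} (hb : b ≠ 0) (K t : ℝ) :
    HasDerivAt (fun t => K / b * (t / 2 - Real.sin (2 * b * t) / (4 * b)))
      (b * ((Real.sin (b * t) / b) ^ 2 * K)) t := by
  have h := (((hasDerivAt_id t).div_const 2).sub
    ((((hasDerivAt_id t).const_mul (2 * b)).sin).div_const (4 * b))).const_mul (K / b)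
  refine h.congr_deriv ?_
  simp only [id]
  rw [show 2 * b * t = 2 * (b * t) by ring, Real.cos_two_mul, Real.cos_sq']
  field_simp
  ring

theorem hasDerivAt_curve {b : ℝ} (hb : b ≠ 0) (c : EuclideanSpace ℝ (Fin n)) (t : ℝ) :
    HasDerivAt (curve 0 0 b c)
      (Real.cos (b * t) • c, b * ‖(Real.sin (b * t) / b) • c‖ ^ 2) t := by
  rw [funext (curve_zero_eq hb c)]
  refine HasDerivAt.prodMk ((hasDerivAt_sin_mul_div hb t).smul_const c) ?_
  refine (hasDerivAt_height hb (‖c‖ ^ 2) t).congr_deriv ?_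
  rw [norm_smul, mul_pow, Real.norm_eq_abs, sq_abs]

theorem curve_velocity_mem_span {b : ℝ} (hb : b ≠ 0) (c : EuclideanSpace ℝ (Fin n)) (t : ℝ) :
    deriv (curve 0 0 b c) t ∈
      Submodule.span ℝ (range fun j => fields n j (curve 0 0 b c t)) := by
  rw [(hasDerivAt_curve hb c t).deriv, mem_span_fields_iff]
  refine ⟨b • (curve 0 0 b c t).1, ?_⟩
  rw [real_inner_smul_left, real_inner_self_eq_norm_sq, curve_zero_eq hb]

theorem curve_speed_sq {b : ℝ} (hb : b ≠ 0) (c : EuclideanSpace ℝ (Fin n)) (t : ℝ) :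
    ‖Real.cos (b * t) • c‖ ^ 2 + ‖b • (Real.sin (b * t) / b) • c‖ ^ 2 = ‖c‖ ^ 2 := by
  rw [smul_smul, mul_div_cancel₀ _ hb, norm_smul, norm_smul, mul_pow, mul_pow, Real.norm_eq_abs,
    Real.norm_eq_abs, sq_abs, sq_abs, ← add_mul, Real.cos_sq_add_sin_sq, one_mul]

theorem vecNorm_curve {b : ℝ} (hb : b ≠ 0) (c : EuclideanSpace ℝ (Fin n)) (t : ℝ) :
    vecNorm (fields n) (curve 0 0 b c t) (deriv (curve 0 0 b c) t) = ENNReal.ofReal ‖c‖ := by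
  rw [vecNorm_fields_eq (curve_velocity_mem_span hb c t), (hasDerivAt_curve hb c t).deriv,
    ← norm_control_sq, curve_zero_eq hb]
  have h := curve_speed_sq hb c t
  dsimp only
  generalize (Real.sin (b * t) / b) • c = x at *
  have e : (b * ‖x‖ ^ 2 / ‖x‖ ^ 2) • x = b • x := by
    by_cases hx : x = 0
    · simp [hx]
    · have : ‖x‖ ≠ 0 := norm_ne_zero_iff.2 hx
      congr 1; field_simp
  rw [e, h, Real.sqrt_sq (norm_nonneg _)]

/-- The trigonometric solution of the Riccati system `a' = -(a² + b²)`, `q' = -a q`, `d' = -q² ‖w‖²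
/ 2`. The shift `μ` places a given interval of length less than `π / b` between two poles of the
tangent. -/
theorem IsHorizontal.calibration_tan {γ : ℝ → Space n} (hγ : IsHorizontal (fields n) γ) {M : ℝ}
    (hM : length (fields n) γ < ENNReal.ofReal M) {b r s μ : ℝ} (hb : b ≠ 0) (hrs : r < s)
    (hcos : ∀ t ∈ Icc r s, Real.cos (b * (t - μ)) ≠ 0) (w : EuclideanSpace ℝ (Fin n)) :
    (b * (γ 1).2 + -b * Real.tan (b * (s - μ)) / 2 * ‖(γ 1).1‖ ^ 2 +
        (Real.cos (b * (s - μ)))⁻¹ * inner ℝ w (γ 1).1 +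
        -‖w‖ ^ 2 * Real.tan (b * (s - μ)) / (2 * b)) -
      (b * (γ 0).2 + -b * Real.tan (b * (r - μ)) / 2 * ‖(γ 0).1‖ ^ 2 +
        (Real.cos (b * (r - μ)))⁻¹ * inner ℝ w (γ 0).1 +
        -‖w‖ ^ 2 * Real.tan (b * (r - μ)) / (2 * b)) ≤
      M ^ 2 / (2 * (s - r)) := by
  have hlin (t : ℝ) : HasDerivAt (fun t => b * (t - μ)) b t := by
    simpa using ((hasDerivAt_id t).sub_const μ).const_mul b
  have htan (t : ℝ) (ht : t ∈ Icc r s) : HasDerivAt (fun t => Real.tan (b * (t - μ)))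
      (1 / Real.cos (b * (t - μ)) ^ 2 * b) t :=
    HasDerivAt.comp (h₂ := Real.tan) t (Real.hasDerivAt_tan (hcos t ht)) (hlin t)
  refine hγ.calibration hM hrs (a := fun t => -b * Real.tan (b * (t - μ)))
    (q := fun t => (Real.cos (b * (t - μ)))⁻¹)
    (d := fun t => -‖w‖ ^ 2 * Real.tan (b * (t - μ)) / (2 * b)) (w := w) ?_ ?_ ?_
  · intro t ht
    refine ((htan t ht).const_mul (-b)).congr_deriv ?_
    have h := hcos t ht
    rw [Real.tan_eq_sin_div_cos]
    field_simp
    linear_combination Real.sin_sq_add_cos_sq (b * (t - μ))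
  · intro t ht
    refine ((hlin t).cos.inv (hcos t ht)).congr_deriv ?_
    have h := hcos t ht
    rw [Real.tan_eq_sin_div_cos]
    field_simp
  · intro t ht
    refine (((htan t ht).const_mul (-‖w‖ ^ 2)).div_const (2 * b)).congr_deriv ?_
    have h := hcos t ht
    field_simp

/-- Along `γ^{b,c}` the calibrating function is affine in `t` with slope `‖c‖² / 2`, so the
calibration inequality is sharp there. This dictates the choice `w = cos (b μ) c`. -/
theorem calibration_along_curve {b μ : ℝ} (hb : b ≠ 0) (c : EuclideanSpace ℝ (Fin n)) {t : ℝ}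
    (h : Real.cos (b * (t - μ)) ≠ 0) :
    b * (curve 0 0 b c t).2 +
        -b * Real.tan (b * (t - μ)) / 2 * ‖(curve 0 0 b c t).1‖ ^ 2 +
        (Real.cos (b * (t - μ)))⁻¹ * inner ℝ (Real.cos (b * μ) • c) (curve 0 0 b c t).1 +
        -‖Real.cos (b * μ) • c‖ ^ 2 * Real.tan (b * (t - μ)) / (2 * b) =
      ‖c‖ ^ 2 * (t / 2 + Real.cos (b * μ) * Real.sin (b * μ) / (2 * b)) := by
  rw [curve_zero_eq hb]
  simp only [norm_smul, real_inner_smul_left, real_inner_smul_right, real_inner_self_eq_norm_sq,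
    mul_pow, Real.norm_eq_abs, sq_abs, Real.tan_eq_sin_div_cos]
  have e : b * μ = b * t - b * (t - μ) := by ring
  have e2 : 2 * b * t = 2 * (b * t) := by ring
  have h1 := Real.sin_sq_add_cos_sq (b * t)
  have h2 := Real.sin_sq_add_cos_sq (b * (t - μ))
  rw [e2, Real.sin_two_mul]
  -- After clearing denominators the identity is a combination of two addition formulas, for `b μ =
  -- b t - b (t - μ)` and `b t = b (t - μ) + b μ`.
  have hc : Real.cos (b * μ) = _ := e ▸ Real.cos_sub (b * t) (b * (t - μ))
  have hs : Real.sin (b * t) = _ :=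
    (show b * t = b * (t - μ) + b * μ by ring) ▸ Real.sin_add (b * (t - μ)) (b * μ)
  generalize Real.sin (b * t) = S at *
  generalize Real.cos (b * t) = C at *
  generalize Real.sin (b * (t - μ)) = S' at *
  generalize Real.cos (b * (t - μ)) = C' at *
  generalize Real.cos (b * μ) = P at *
  generalize Real.sin (b * μ) = Q at *
  field_simp
  linear_combination ‖c‖ ^ 2 * (4 * S * hc + 4 * P * hs)

theorem le_length_of_curve_endpoints {b r s : ℝ} (hb : 0 < b) (hrs : r < s) (hbrs : b * (s - r) < Real.pi)
    (c : EuclideanSpace ℝ (Fin n)) {γ : ℝ → Space n} (hγ : IsHorizontal (fields n) γ)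
    (h0 : γ 0 = curve 0 0 b c r) (h1 : γ 1 = curve 0 0 b c s) :
    ENNReal.ofReal (‖c‖ * (s - r)) ≤ length (fields n) γ := by
  by_contra! hlt
  obtain ⟨M', hM1, hM2⟩ := exists_between hlt
  have hfin : M' ≠ ∞ := hM2.ne_top
  rw [← ENNReal.ofReal_toReal hfin] at hM1 hM2
  have hM3 := (ENNReal.ofReal_lt_ofReal_iff_of_nonneg ENNReal.toReal_nonneg).1 hM2
  -- With `μ` the midpoint of `[r, s]`, the angle stays in `(-π/2, π/2)` because `b (s - r) < π`.
  have hcos : ∀ t ∈ Icc r s, Real.cos (b * (t - (r + s) / 2)) ≠ 0 := by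
    intro t ht
    refine (Real.cos_pos_of_mem_Ioo ⟨?_, ?_⟩).ne' <;> nlinarith [ht.1, ht.2]
  have h := hγ.calibration_tan hM1 hb.ne' hrs hcos (Real.cos (b * ((r + s) / 2)) • c)
  rw [h0, h1, calibration_along_curve hb.ne' c (hcos s (right_mem_Icc.2 hrs.le)),
    calibration_along_curve hb.ne' c (hcos r (left_mem_Icc.2 hrs.le)),
    le_div_iff₀ (by linarith)] at h
  have h4 : (‖c‖ * (s - r)) ^ 2 ≤ M'.toReal ^ 2 := by nlinarith
  exact absurd (pow_le_pow_left₀ ENNReal.toReal_nonneg hM3.le 2) (by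
    have := pow_lt_pow_left₀ hM3 ENNReal.toReal_nonneg two_ne_zero
    linarith)

theorem dCC_curve_le {b r s : ℝ} (hb : b ≠ 0) (hrs : r < s) (c : EuclideanSpace ℝ (Fin n)) :
    dCC (fields n) (curve 0 0 b c r) (curve 0 0 b c s) ≤ ENNReal.ofReal (‖c‖ * (s - r)) := by
  have hl : 0 < s - r := sub_pos.2 hrs
  have hα : Continuous fun t => Real.cos (b * t) • c := by fun_prop
  have hβ : Continuous fun t => b • (Real.sin (b * t) / b) • c := by fun_prop
  have hsq (x y : EuclideanSpace ℝ (Fin n)) (h : ‖x‖ ^ 2 + ‖y‖ ^ 2 = ‖c‖ ^ 2) :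
      ‖x‖ ≤ ‖c‖ ∧ ‖y‖ ≤ ‖c‖ :=
    ⟨(sq_le_sq₀ (norm_nonneg _) (norm_nonneg _)).1 (by nlinarith [sq_nonneg ‖y‖]),
      (sq_le_sq₀ (norm_nonneg _) (norm_nonneg _)).1 (by nlinarith [sq_nonneg ‖x‖])⟩
  have h := dCC_le_of_controls hrs hα.stronglyMeasurable hβ.stronglyMeasurable
    (fun t => (hsq _ _ (curve_speed_sq hb c t)).1) (fun t => (hsq _ _ (curve_speed_sq hb c t)).2)
    (fun t => (Real.sin (b * t) / b) • c) (fun t => by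
      rw [intervalIntegral.integral_eq_sub_of_hasDerivAt
        (fun t' _ => (hasDerivAt_sin_mul_div hb t').smul_const c) (hα.intervalIntegrable _ _)]
      abel) (curve 0 0 b c r).2
  convert h using 2
  · rw [curve_zero_eq hb]
  · rw [curve_zero_eq hb, curve_zero_eq hb]
    congr 1
    have e (t : ℝ) : inner ℝ (b • (Real.sin (b * t) / b) • c) ((Real.sin (b * t) / b) • c) =
        b * ((Real.sin (b * t) / b) ^ 2 * ‖c‖ ^ 2) := by
      rw [real_inner_smul_left, real_inner_self_eq_norm_sq, norm_smul, mul_pow, Real.norm_eq_abs,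
        sq_abs]
    simp only [e]
    rw [intervalIntegral.integral_eq_sub_of_hasDerivAt
      (fun t' _ => hasDerivAt_height hb (‖c‖ ^ 2) t')
      (Continuous.intervalIntegrable (by fun_prop) _ _)]
    ring
  · simp only [curve_speed_sq hb]
    rw [intervalIntegral.integral_const, smul_eq_mul, ← mul_assoc, ← sq, ← mul_pow,
      Real.sqrt_sq (by positivity), mul_comm]

theorem dCC_curve {b r s : ℝ} (hb : 0 < b) (hrs : r ≤ s) (hbrs : b * (s - r) < Real.pi)
    (c : EuclideanSpace ℝ (Fin n)) :
    dCC (fields n) (curve 0 0 b c r) (curve 0 0 b c s) = ENNReal.ofReal (‖c‖ * (s - r)) := by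
  rcases hrs.eq_or_lt with rfl | hrs
  · simp [dCC_self]
  · exact le_antisymm (dCC_curve_le hb.ne' hrs c)
      (le_iInf₂ fun γ hγ => le_length_of_curve_endpoints hb hrs hbrs c hγ.1 hγ.2.1 hγ.2.2)

theorem ae_eq_deriv_of_eqOn {E : Type*} [NormedAddCommGroup E] [NormedSpace ℝ E] {f g : ℝ → E}
    {a b : ℝ} (h : EqOn f g (Icc a b)) :
    ∀ᵐ t ∂(volume.restrict (Icc a b)), f t = g t ∧ deriv f t = deriv g t := by
  rw [← restrict_Ioo_eq_restrict_Icc]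
  filter_upwards [ae_restrict_mem measurableSet_Ioo] with t ht
  refine ⟨h (Ioo_subset_Icc_self ht), Filter.EventuallyEq.deriv_eq ?_⟩
  exact Filter.eventuallyEq_of_mem (Icc_mem_nhds ht.1 ht.2) h

theorem lengthOn_of_eqOn_curve {b r s : ℝ} (hb : b ≠ 0) {c : EuclideanSpace ℝ (Fin n)}
    {γ : ℝ → Space n} (h : EqOn γ (curve 0 0 b c) (Icc 0 1)) (hr : 0 ≤ r) (hs : s ≤ 1) :
    lengthOn (fields n) γ r s = ENNReal.ofReal (‖c‖ * (s - r)) := by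
  have h1 : lengthOn (fields n) γ r s = ∫⁻ _ in Icc r s, ENNReal.ofReal ‖c‖ := by
    refine lintegral_congr_ae (ae_restrict_of_ae_restrict_of_subset (Icc_subset_Icc hr hs) ?_)
    filter_upwards [ae_eq_deriv_of_eqOn h] with t ht
    rw [ht.1, ht.2, vecNorm_curve hb]
  rw [h1, setLIntegral_const, Real.volume_Icc, ENNReal.ofReal_mul (norm_nonneg _)]

theorem isGeodesic_of_eqOn_curve {b : ℝ} (hb : 0 < b) {c : EuclideanSpace ℝ (Fin n)}
    {γ : ℝ → Space n} (h : EqOn γ (curve 0 0 b c) (Icc 0 1)) : IsGeodesic (fields n) γ where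
  horizontal := by
    constructor
    · have hs : ContDiff ℝ 1 (curve 0 0 b c) := by
        rw [funext (curve_zero_eq hb.ne' c)]
        fun_prop
      refine absolutelyContinuous_congr hs.contDiffOn.absolutelyContinuousOnInterval ?_
      rw [uIcc_of_le zero_le_one]
      exact h.symm
    · filter_upwards [ae_eq_deriv_of_eqOn h] with t ht
      rw [ht.1, ht.2]
      exact curve_velocity_mem_span hb.ne' c t
  constSpeed := by
    refine ⟨‖c‖₊, ?_⟩
    filter_upwards [ae_eq_deriv_of_eqOn h] with t ht
    rw [ht.1, ht.2, vecNorm_curve hb.ne', ← coe_nnnorm, ENNReal.ofReal_coe_nnreal]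
  locallyMinimizing := by
    intro t _
    -- Two parameters within `π / (2b)` of `t` differ by less than `π / b`, the range of
    -- `dCC_curve`.
    refine ⟨Real.pi / (2 * b), by positivity, fun r hr s hs hrt hst hrs => ?_⟩
    rw [lengthOn_of_eqOn_curve hb.ne' h hr.1 hs.2, h hr, h hs, dCC_curve hb hrs]
    rw [abs_lt] at hrt hst
    have h1 : s - r < Real.pi / b := by
      have : Real.pi / b = Real.pi / (2 * b) + Real.pi / (2 * b) := by field_simp; norm_num
      linarith [hrt.1, hst.2]
    rwa [lt_div_iff₀ hb, mul_comm] at h1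

theorem curve_one {m : ℕ} (hm : 1 ≤ m) {u : ℝ} (hu : 0 < u) {c : EuclideanSpace ℝ (Fin n)}
    (hc : ‖c‖ = √(2 * m * Real.pi * u)) : curve 0 0 (m * Real.pi) c 1 = (0, u) := by
  have hm0 : (0 : ℝ) < m := by exact_mod_cast hm
  have hpi := Real.pi_pos
  have hb : (m : ℝ) * Real.pi ≠ 0 := by positivity
  have h2 : Real.sin (2 * (m * Real.pi) * 1) = 0 := by
    have := Real.sin_nat_mul_pi (2 * m)
    push_cast at this
    rw [← this]; congr 1; ring
  rw [curve_zero_eq hb, h2, mul_one, Real.sin_nat_mul_pi, hc, Real.sq_sqrt (by positivity)]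
  refine Prod.ext (by simp) ?_
  simp only
  field_simp
  ring

theorem isGeodesicFromTo_of_eqOn_curve {m : ℕ} (hm : 1 ≤ m) {u : ℝ} (hu : 0 < u)
    {c : EuclideanSpace ℝ (Fin n)} (hc : ‖c‖ = √(2 * m * Real.pi * u)) {γ : ℝ → Space n}
    (h : EqOn γ (curve 0 0 (m * Real.pi) c) (Icc 0 1)) :
    IsGeodesicFromTo (fields n) γ (0, 0) (0, u) := by
  have hm0 : (0 : ℝ) < m := by exact_mod_cast hm
  have hpi := Real.pi_pos
  refine ⟨isGeodesic_of_eqOn_curve (by positivity) h, ?_, ?_⟩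
  · rw [h (by simp), curve_zero_eq (by positivity)]; simp
  · rw [h (by simp), curve_one hm hu hc]

theorem length_of_eqOn_curve {b : ℝ} (hb : b ≠ 0) {c : EuclideanSpace ℝ (Fin n)}
    {γ : ℝ → Space n} (h : EqOn γ (curve 0 0 b c) (Icc 0 1)) :
    length (fields n) γ = ENNReal.ofReal ‖c‖ := by
  rw [length, lengthOn_of_eqOn_curve hb h le_rfl le_rfl]; simp

/-- Both endpoints have `x = 0`, so with `w = 0` only the term `b υ` of the calibration survives: `2
b u ≤ M²` for every `b < π`. The tangent blows up at `b = π`, which is therefore reached only as a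
limit. -/
theorem le_length_vertical {u : ℝ} {γ : ℝ → Space n} (hγ : IsHorizontal (fields n) γ)
    (h0 : γ 0 = (0, 0)) (h1 : γ 1 = (0, u)) :
    ENNReal.ofReal √(2 * Real.pi * u) ≤ length (fields n) γ := by
  by_contra! hlt
  obtain ⟨M', hM1, hM2⟩ := exists_between hlt
  have hfin : M' ≠ ∞ := hM2.ne_top
  rw [← ENNReal.ofReal_toReal hfin] at hM1 hM2
  have hM3 := (ENNReal.ofReal_lt_ofReal_iff_of_nonneg ENNReal.toReal_nonneg).1 hM2
  have key : ∀ b ∈ Ioo 0 Real.pi, 2 * b * u ≤ M'.toReal ^ 2 := by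
    intro b hb
    have h := hγ.calibration_tan hM1 hb.1.ne' (r := -(1 / 2)) (s := 1 / 2) (μ := 0) (by norm_num)
      (fun t ht => (Real.cos_pos_of_mem_Ioo ⟨by nlinarith [ht.1, ht.2, hb.1, hb.2],
        by nlinarith [ht.1, ht.2, hb.1, hb.2]⟩).ne') 0
    rw [h0, h1] at h
    norm_num at h
    linarith
  have hlim : 2 * Real.pi * u ≤ M'.toReal ^ 2 := by
    have hc : Filter.Tendsto (fun b => 2 * b * u) (nhdsWithin Real.pi (Iio Real.pi))
        (nhds (2 * Real.pi * u)) :=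
      ((by fun_prop : Continuous fun b : ℝ => 2 * b * u).tendsto Real.pi).mono_left
        nhdsWithin_le_nhds
    refine le_of_tendsto hc ?_
    filter_upwards [Ioo_mem_nhdsLT Real.pi_pos] with b hb using key b hb
  exact absurd hM3 (not_lt.2 (Real.sqrt_le_left ENNReal.toReal_nonneg |>.2 hlim))

end ExplicitCurves

/-! ### From geodesics to minimal controls -/

section Controls

variable {n : ℕ}

/-- Controls `α`, `β` of constant total norm `v` whose trajectory `x` has minimal energy on the
subintervals of `[0, 1]` shorter than `δ`. The competitors `α'` steer `x'` between the same
end points; the best second control is then proportional to `x'`. -/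
structure LocallyMinimal (v δ : ℝ) (α β x : ℝ → EuclideanSpace ℝ (Fin n)) : Prop where
  stronglyMeasurable_fst : StronglyMeasurable α
  stronglyMeasurable_snd : StronglyMeasurable β
  norm_fst_le : ∀ t, ‖α t‖ ≤ v
  norm_snd_le : ∀ t, ‖β t‖ ≤ v
  trajectory : ∀ t, x t = x 0 + ∫ s in (0 : ℝ)..t, α s
  norm_sq : ∀ᵐ t, t ∈ Icc (0 : ℝ) 1 → ‖α t‖ ^ 2 + ‖β t‖ ^ 2 = v ^ 2
  snd_eq_zero : ∀ᵐ t, t ∈ Icc (0 : ℝ) 1 → x t = 0 → β t = 0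
  minimal : ∀ r s, 0 ≤ r → r < s → s ≤ 1 → s - r < δ →
    ∀ (α' x' : ℝ → EuclideanSpace ℝ (Fin n)) (K : ℝ), StronglyMeasurable α' → (∀ t, ‖α' t‖ ≤ K) →
      (∀ t, x' t = x' r + ∫ s in r..t, α' s) → x' r = x r → x' s = x s →
      0 < ∫ t in r..s, ‖x' t‖ ^ 2 →
      (s - r) * v ^ 2 ≤ (∫ t in r..s, ‖α' t‖ ^ 2) +
        (∫ t in r..s, inner ℝ (β t) (x t)) ^ 2 / ∫ t in r..s, ‖x' t‖ ^ 2

theorem continuous_trajectory {α x : ℝ → EuclideanSpace ℝ (Fin n)} {K r : ℝ}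
    (hα : StronglyMeasurable α) (hK : ∀ t, ‖α t‖ ≤ K) (hx : ∀ t, x t = x r + ∫ s in r..t, α s) :
    Continuous x := by
  rw [funext hx]
  exact continuous_const.add
    (intervalIntegral.continuous_primitive (integrableOn_of_measurable_bounded hα hK) r)

/-- The Lebesgue number of the cover of `[0, 1]` by the neighbourhoods from local minimality. -/
theorem IsGeodesic.exists_uniform {γ : ℝ → Space n} (hγ : IsGeodesic (fields n) γ) :
    ∃ δ > 0, ∀ r s, 0 ≤ r → r < s → s ≤ 1 → s - r < δ →
      lengthOn (fields n) γ r s = dCC (fields n) (γ r) (γ s) := by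
  choose! ε hε H using hγ.locallyMinimizing
  obtain ⟨δ, hδ, hball⟩ := lebesgue_number_lemma_of_metric (s := Icc (0 : ℝ) 1)
    (c := fun t : Icc (0 : ℝ) 1 => Metric.ball (t : ℝ) (ε t)) isCompact_Icc
    (fun _ => Metric.isOpen_ball)
    (fun t ht => mem_iUnion.2 ⟨⟨t, ht⟩, Metric.mem_ball_self (hε t ht)⟩)
  refine ⟨δ, hδ, fun r s hr hrs hs hd => ?_⟩
  obtain ⟨t, ht⟩ := hball r ⟨hr, hrs.le.trans hs⟩
  have h1 := ht (Metric.mem_ball_self hδ)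
  have h2 := ht (show s ∈ Metric.ball r δ by
    rw [Metric.mem_ball, Real.dist_eq, abs_of_pos (sub_pos.2 hrs)]; exact hd)
  rw [Metric.mem_ball, Real.dist_eq] at h1 h2
  exact H t t.2 r ⟨hr, hrs.le.trans hs⟩ s ⟨hr.trans hrs.le, hs⟩ h1 h2 hrs.le

/-- Along a fixed `x`, the second control is taken to be `l x`, with the constant `l` fixed by the
height `u₁ - u₀` to be gained. By Cauchy–Schwarz this is the cheapest choice, and it costs `(u₁ -
u₀)² / ∫ ‖x‖²`. -/
theorem dCC_le_of_trajectory {α x : ℝ → EuclideanSpace ℝ (Fin n)} {K r s : ℝ} (hrs : r < s)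
    (hα : StronglyMeasurable α) (hK : ∀ t, ‖α t‖ ≤ K) (hx : ∀ t, x t = x r + ∫ s in r..t, α s)
    (hG : 0 < ∫ t in r..s, ‖x t‖ ^ 2) (u₀ u₁ : ℝ) :
    dCC (fields n) (x r, u₀) (x s, u₁) ≤ ENNReal.ofReal √((s - r) *
      ((∫ t in r..s, ‖α t‖ ^ 2) + (u₁ - u₀) ^ 2 / ∫ t in r..s, ‖x t‖ ^ 2)) := by
  have hxc := continuous_trajectory hα hK hx
  set G := ∫ t in r..s, ‖x t‖ ^ 2 with hGdef
  set l := (u₁ - u₀) / G with hl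
  set β := (Icc r s).indicator fun t => l • x t with hβ
  have hβe : ∀ t ∈ Icc r s, β t = l • x t := fun t ht => indicator_of_mem ht _
  obtain ⟨D, hD⟩ := isCompact_Icc.exists_bound_of_continuousOn (s := Icc r s)
    (f := fun t => l • x t) (by fun_prop)
  have hβm : StronglyMeasurable β :=
    (hxc.const_smul l).stronglyMeasurable.indicator measurableSet_Icc
  have hD0 : 0 ≤ D := (norm_nonneg _).trans (hD r (left_mem_Icc.2 hrs.le))
  have hβD (t : ℝ) : ‖β t‖ ≤ max K D := by
    by_cases ht : t ∈ Icc r s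
    · rw [hβe t ht]; exact (hD t ht).trans (le_max_right _ _)
    · rw [hβ, indicator_of_notMem ht, norm_zero]; exact hD0.trans (le_max_right _ _)
  have h := dCC_le_of_controls hrs hα hβm (fun t => (hK t).trans (le_max_left K D)) hβD x hx u₀
  have e1 : ∫ t in r..s, inner ℝ (β t) (x t) = u₁ - u₀ := by
    have : ∫ t in r..s, inner ℝ (β t) (x t) = ∫ t in r..s, l * ‖x t‖ ^ 2 := by
      refine intervalIntegral.integral_congr fun t ht => ?_
      rw [uIcc_of_le hrs.le] at ht
      simp only [hβe t ht, real_inner_smul_left, real_inner_self_eq_norm_sq]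
    rw [this, intervalIntegral.integral_const_mul, ← hGdef, hl]
    field_simp
  have e2 : ∫ t in r..s, ‖α t‖ ^ 2 + ‖β t‖ ^ 2 =
      (∫ t in r..s, ‖α t‖ ^ 2) + (u₁ - u₀) ^ 2 / G := by
    rw [intervalIntegral.integral_add]
    · congr 1
      have : ∫ t in r..s, ‖β t‖ ^ 2 = ∫ t in r..s, l ^ 2 * ‖x t‖ ^ 2 := by
        refine intervalIntegral.integral_congr fun t ht => ?_
        rw [uIcc_of_le hrs.le] at ht
        simp only [hβe t ht, norm_smul, mul_pow, Real.norm_eq_abs, sq_abs]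
      rw [this, intervalIntegral.integral_const_mul, ← hGdef, hl]
      field_simp
    · refine integrableOn_of_measurable_bounded (K := K ^ 2) (hα.norm.pow 2) (fun t => ?_) r s
      simpa using pow_le_pow_left₀ (norm_nonneg _) (hK t) 2
    · refine integrableOn_of_measurable_bounded (K := max K D ^ 2) (hβm.norm.pow 2)
        (fun t => ?_) r s
      simpa using pow_le_pow_left₀ (norm_nonneg _) (hβD t) 2
  rw [e1, e2] at h
  simpa using h

theorem IsGeodesic.exists_controls {γ : ℝ → Space n} (hγ : IsGeodesic (fields n) γ) :
    ∃ v δ : ℝ, 0 < δ ∧ ∃ α β x : ℝ → EuclideanSpace ℝ (Fin n), LocallyMinimal v δ α β x ∧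
      ∀ t ∈ Icc (0 : ℝ) 1, γ t = (x t, (γ 0).2 + ∫ s in (0 : ℝ)..t, inner ℝ (β s) (x s)) := by
  obtain ⟨δ, hδ, hmin⟩ := hγ.exists_uniform
  obtain ⟨v, hv⟩ := hγ.constSpeed
  have hγc : ContinuousOn γ (Icc 0 1) := by
    have := hγ.horizontal.ac.continuousOn
    rwa [uIcc_of_le zero_le_one] at this
  -- `γ` is arbitrary outside `[0, 1]`; the constant extension makes the control below measurable on
  -- all of `ℝ`.
  set p : ℝ → Space n := IccExtend zero_le_one ((Icc (0 : ℝ) 1).domRestrict γ) with hp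
  have hpc : Continuous p := hγc.domRestrict.Icc_extend'
  have hpe : ∀ t ∈ Icc (0 : ℝ) 1, p t = γ t := fun t ht => by
    rw [hp, IccExtend_of_mem _ _ ht]; rfl
  have hdm : Measurable (deriv γ) := measurable_deriv γ
  set B : ℝ → EuclideanSpace ℝ (Fin n) := fun t => ((deriv γ t).2 / ‖(p t).1‖ ^ 2) • (p t).1 with hB
  have hBm : Measurable B :=
    (hdm.snd.div (hpc.fst.norm.measurable.pow_const 2)).smul hpc.fst.measurable
  -- Cutting off at `v` changes the controls only on a null subset of `[0, 1]` and makes the bounds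
  -- hold for every `t`.
  set α : ℝ → EuclideanSpace ℝ (Fin n) :=
    fun t => if ‖(deriv γ t).1‖ ≤ v then (deriv γ t).1 else 0 with hα
  set β : ℝ → EuclideanSpace ℝ (Fin n) := fun t => if ‖B t‖ ≤ v then B t else 0 with hβ
  have hαm : StronglyMeasurable α := (Measurable.ite
    (measurableSet_le hdm.fst.norm measurable_const) hdm.fst measurable_const).stronglyMeasurable
  have hβm : StronglyMeasurable β := (Measurable.ite
    (measurableSet_le hBm.norm measurable_const) hBm measurable_const).stronglyMeasurable
  have hαv (t : ℝ) : ‖α t‖ ≤ v := by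
    simp only [hα]; split_ifs with h
    · exact h
    · simp
  have hβv (t : ℝ) : ‖β t‖ ≤ v := by
    simp only [hβ]; split_ifs with h
    · exact h
    · simp
  set x : ℝ → EuclideanSpace ℝ (Fin n) := fun t => (γ 0).1 + ∫ s in (0 : ℝ)..t, α s with hx
  have hx0 : ∀ t, x t = x 0 + ∫ s in (0 : ℝ)..t, α s := fun t => by simp [hx]
  have hxc := continuous_trajectory hαm hαv hx0
  have hαi := integrableOn_of_measurable_bounded hαm hαv
  have hβi := intervalIntegrable_inner_of_bounded hβm hβv hxc
  have hae : ∀ᵐ t, t ∈ Icc (0 : ℝ) 1 → (deriv γ t).1 = α t ∧ B t = β t ∧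
      (deriv γ t).2 = inner ℝ (β t) (γ t).1 ∧ ‖α t‖ ^ 2 + ‖β t‖ ^ 2 = (v : ℝ) ^ 2 := by
    have h1 := hγ.horizontal.tangent
    have h2 := hγ.horizontal.ae_vecNorm_eq
    rw [ae_restrict_iff' measurableSet_Icc] at h1 h2 hv
    filter_upwards [h1, h2, hv] with t h1 h2 h3 ht
    have h4 : speed (γ t) (deriv γ t) = v := by
      have := (h2 ht).symm.trans (h3 ht)
      rw [← ENNReal.ofReal_coe_nnreal,
        ENNReal.ofReal_eq_ofReal_iff (speed_nonneg _ _) v.coe_nonneg] at this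
      exact this
    have hBt : B t = ((deriv γ t).2 / ‖(γ t).1‖ ^ 2) • (γ t).1 := by simp only [hB, hpe t ht]
    have h5 : ‖(deriv γ t).1‖ ^ 2 + ‖B t‖ ^ 2 = (v : ℝ) ^ 2 := by
      rw [hBt, norm_control_sq, ← h4, speed, Real.sq_sqrt (by positivity)]
    have h6 : ‖(deriv γ t).1‖ ≤ v :=
      (sq_le_sq₀ (norm_nonneg _) v.coe_nonneg).1 (by nlinarith [sq_nonneg ‖B t‖])
    have h7 : ‖B t‖ ≤ v :=
      (sq_le_sq₀ (norm_nonneg _) v.coe_nonneg).1 (by nlinarith [sq_nonneg ‖(deriv γ t).1‖])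
    have h8 : α t = (deriv γ t).1 := if_pos h6
    have h9 : β t = B t := if_pos h7
    refine ⟨h8.symm, h9.symm, ?_, ?_⟩
    · rw [h9, hBt]; exact snd_eq_inner_of_mem_span (h1 ht)
    · rw [h8, h9, h5]
  have hdiff : ∀ᵐ t, t ∈ Icc (0 : ℝ) 1 → DifferentiableAt ℝ γ t := by
    have := hγ.horizontal.ac.boundedVariationOn.ae_differentiableAt_of_mem_uIcc
    rwa [uIcc_of_le zero_le_one] at this
  have hγx : ∀ t ∈ Icc (0 : ℝ) 1, (γ t).1 = x t := by
    -- An absolutely continuous function with a.e. vanishing derivative is constant.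
    have hac : AbsolutelyContinuousOnInterval (fun t => (γ t).1 - ∫ s in (0 : ℝ)..t, α s) 0 1 := by
      have h := lipschitzOnWith_primitive (a := 0) (b := 1) (fun s _ => hαi 0 s) fun t _ => hαv t
      rw [← uIcc_of_le zero_le_one] at h
      exact (absolutelyContinuous_comp hγ.horizontal.ac LipschitzWith.prod_fst.lipschitzOnWith
        (mapsTo_univ _ _)).fun_sub h.absolutelyContinuousOnInterval
    obtain ⟨C, hC⟩ := hac.const_of_ae_hasDerivAt_zero (by
      filter_upwards [hdiff, hae, (hαi 0 1).ae_hasDerivAt_integral] with t h1 h2 h3 ht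
      have ht' : t ∈ Icc (0 : ℝ) 1 := by rwa [uIcc_of_le zero_le_one] at ht
      have h4 : HasDerivAt (fun t => (γ t).1) (deriv γ t).1 t := (h1 ht').hasDerivAt.fst
      refine (h4.sub (h3 ht 0 (by simp))).congr_deriv ?_
      rw [(h2 ht').1, sub_self])
    intro t ht
    have e0 := hC 0 (by simp)
    have et := hC t (by rwa [uIcc_of_le zero_le_one])
    simp only [intervalIntegral.integral_same, sub_zero] at e0
    rw [← e0] at et
    rw [sub_eq_iff_eq_add] at et
    exact et
  have hγu : ∀ t ∈ Icc (0 : ℝ) 1,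
      (γ t).2 = (γ 0).2 + ∫ s in (0 : ℝ)..t, inner ℝ (β s) (x s) := by
    intro t ht
    have hac : AbsolutelyContinuousOnInterval (fun t => (γ t).2) 0 t :=
      (absolutelyContinuous_comp hγ.horizontal.ac LipschitzWith.prod_snd.lipschitzOnWith
        (mapsTo_univ _ _)).mono (by
          rw [uIcc_of_le ht.1, uIcc_of_le zero_le_one]; exact Icc_subset_Icc_right ht.2)
    have h := (integral_eq_sub_of_absolutelyContinuous (f' := fun s => inner ℝ (β s) (x s))
      ht.1 hac (by
      filter_upwards [hdiff, hae] with s h1 h2 hs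
      have hs' : s ∈ Icc (0 : ℝ) 1 := ⟨hs.1, hs.2.trans ht.2⟩
      have h4 : HasDerivAt (fun t => (γ t).2) (deriv γ s).2 s := (h1 hs').hasDerivAt.snd
      refine h4.congr_deriv ?_
      rw [(h2 hs').2.2.1, hγx s hs'])).2
    rw [h]; ring
  refine ⟨v, δ, hδ, α, β, x, ?_, fun t ht => Prod.ext (hγx t ht) (hγu t ht)⟩
  refine ⟨hαm, hβm, hαv, hβv, hx0, ?_, ?_, ?_⟩
  · filter_upwards [hae] with t h ht using (h ht).2.2.2
  · filter_upwards [hae] with t h ht h0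
    rw [← (h ht).2.1]
    simp only [hB, hpe t ht, hγx t ht, h0, smul_zero]
  · intro r s hr hrs hs hd α' x' K hα' hK hx' hr' hs' hG
    have hrI : r ∈ Icc (0 : ℝ) 1 := ⟨hr, hrs.le.trans hs⟩
    have hsI : s ∈ Icc (0 : ℝ) 1 := ⟨hr.trans hrs.le, hs⟩
    have h1 := dCC_le_of_trajectory hrs hα' hK hx' hG (γ r).2 (γ s).2
    have e : (γ s).2 - (γ r).2 = ∫ t in r..s, inner ℝ (β t) (x t) := by
      rw [hγu s hsI, hγu r hrI, ← intervalIntegral.integral_interval_sub_left (hβi 0 s) (hβi 0 r)]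
      ring
    have hlen : lengthOn (fields n) γ r s = ENNReal.ofReal (v * (s - r)) := by
      have h2 : lengthOn (fields n) γ r s = ∫⁻ _ in Icc r s, (v : ℝ≥0∞) :=
        lintegral_congr_ae
          (ae_restrict_of_ae_restrict_of_subset (Icc_subset_Icc hr hs) hv)
      rw [h2, setLIntegral_const, Real.volume_Icc, ENNReal.ofReal_mul v.coe_nonneg,
        ENNReal.ofReal_coe_nnreal]
    rw [hr', hs', ← hγx r hrI, ← hγx s hsI] at h1
    rw [← hmin r s hr hrs hs hd, hlen, e, ENNReal.ofReal_le_ofReal_iff (Real.sqrt_nonneg _)] at h1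
    have hl : 0 < s - r := sub_pos.2 hrs
    have h4 : 0 ≤ ∫ t in r..s, ‖α' t‖ ^ 2 :=
      intervalIntegral.integral_nonneg hrs.le fun t _ => by positivity
    have h3 := pow_le_pow_left₀ (by positivity) h1 2
    rw [Real.sq_sqrt (by positivity)] at h3
    refine le_of_mul_le_mul_left ?_ hl
    calc (s - r) * ((s - r) * (v : ℝ) ^ 2) = (v * (s - r)) ^ 2 := by ring
      _ ≤ _ := h3

end Controls

/-! ### Euler–Lagrange equations -/

section EulerLagrange

variable {n : ℕ}

theorem intervalIntegrable_inner {f g : ℝ → EuclideanSpace ℝ (Fin n)} {K K' : ℝ}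
    (hf : StronglyMeasurable f) (hfK : ∀ t, ‖f t‖ ≤ K) (hg : StronglyMeasurable g)
    (hgK : ∀ t, ‖g t‖ ≤ K') (r s : ℝ) :
    IntervalIntegrable (fun t => (inner ℝ (f t) (g t) : ℝ)) volume r s :=
  integrableOn_of_measurable_bounded (K := K * K') (hf.inner hg) (fun t =>
    (norm_inner_le_norm _ _).trans (mul_le_mul (hfK t) (hgK t) (norm_nonneg _)
      ((norm_nonneg _).trans (hfK t)))) r s

theorem intervalIntegrable_norm_sq {f : ℝ → EuclideanSpace ℝ (Fin n)} {K : ℝ}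
    (hf : StronglyMeasurable f) (hfK : ∀ t, ‖f t‖ ≤ K) (r s : ℝ) :
    IntervalIntegrable (fun t => ‖f t‖ ^ 2) volume r s := by
  simpa only [real_inner_self_eq_norm_sq] using intervalIntegrable_inner hf hfK hf hfK r s

theorem ae_eq_zero_of_integral_norm_sq_le {f : ℝ → EuclideanSpace ℝ (Fin n)} {r s : ℝ}
    (hrs : r < s) (hi : IntervalIntegrable (fun t => ‖f t‖ ^ 2) volume r s)
    (h : ∫ t in r..s, ‖f t‖ ^ 2 ≤ 0) : ∀ᵐ t, t ∈ Icc r s → f t = 0 := by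
  have h0 : ∫ t in r..s, ‖f t‖ ^ 2 = 0 :=
    le_antisymm h (intervalIntegral.integral_nonneg hrs.le fun t _ => by positivity)
  rw [intervalIntegral.integral_eq_zero_iff_of_le_of_nonneg_ae hrs.le
    (Filter.Eventually.of_forall fun t => by simp) hi] at h0
  rw [← ae_restrict_iff' measurableSet_Icc, ← restrict_Ioc_eq_restrict_Icc]
  filter_upwards [h0] with t ht
  simpa using ht

theorem not_ae_false {r s : ℝ} (hrs : r < s) : ¬ ∀ᵐ t : ℝ, t ∉ Ioo r s := by
  intro h
  rw [ae_iff] at h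
  simp only [not_not, ofPred_mem_eq, Real.volume_Ioo, ENNReal.ofReal_eq_zero] at h
  linarith

/-- The right-hand side is differentiable in `ε` with a local minimum at `0`, where its derivative
is `2B - 2HD²/G²`. -/
theorem first_variation_eq_zero {A B C D G H K : ℝ} (hG : 0 < G)
    (h : ∀ ε, 0 < G + 2 * ε * H + ε ^ 2 * K →
      A + D ^ 2 / G ≤ A + 2 * ε * B + ε ^ 2 * C + D ^ 2 / (G + 2 * ε * H + ε ^ 2 * K)) :
    B = (D / G) ^ 2 * H := by
  have hd0 : HasDerivAt (fun ε => G + 2 * ε * H + ε ^ 2 * K) (2 * H) 0 := by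
    have := ((((hasDerivAt_id (0 : ℝ)).const_mul 2).mul_const H).const_add G).add
      (((hasDerivAt_id (0 : ℝ)).pow 2).mul_const K)
    refine this.congr_deriv ?_
    simp
  have hd1 : HasDerivAt (fun ε => A + 2 * ε * B + ε ^ 2 * C) (2 * B) 0 := by
    have := ((((hasDerivAt_id (0 : ℝ)).const_mul 2).mul_const B).const_add A).add
      (((hasDerivAt_id (0 : ℝ)).pow 2).mul_const C)
    refine this.congr_deriv ?_
    simp
  have hd : HasDerivAt (fun ε => A + 2 * ε * B + ε ^ 2 * C + D ^ 2 / (G + 2 * ε * H + ε ^ 2 * K))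
      (2 * B - D ^ 2 * (2 * H) / G ^ 2) 0 := by
    have := hd1.add ((hasDerivAt_const (0 : ℝ) (D ^ 2)).div hd0 (by simp [hG.ne']))
    refine this.congr_deriv ?_
    simp; ring
  have hmin : IsLocalMin
      (fun ε => A + 2 * ε * B + ε ^ 2 * C + D ^ 2 / (G + 2 * ε * H + ε ^ 2 * K)) 0 := by
    have hpos : ∀ᶠ ε in nhds (0 : ℝ), 0 < G + 2 * ε * H + ε ^ 2 * K :=
      hd0.continuousAt.eventually (lt_mem_nhds (by simpa using hG))
    filter_upwards [hpos] with ε hε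
    simpa using h ε hε
  have := hmin.hasDerivAt_eq_zero hd
  field_simp at this ⊢
  linarith

namespace LocallyMinimal

variable {v δ : ℝ} {α β x : ℝ → EuclideanSpace ℝ (Fin n)}

theorem continuous (h : LocallyMinimal v δ α β x) : Continuous x :=
  continuous_trajectory h.stronglyMeasurable_fst h.norm_fst_le h.trajectory

theorem ae_hasDerivAt (h : LocallyMinimal v δ α β x) :
    ∀ᵐ t, t ∈ Icc (0 : ℝ) 1 → HasDerivAt x (α t) t := by
  filter_upwards [(integrableOn_of_measurable_bounded h.stronglyMeasurable_fst h.norm_fst_le 0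
    1).ae_hasDerivAt_integral] with t h1 ht
  rw [funext h.trajectory]
  exact (h1 (by rwa [uIcc_of_le zero_le_one]) 0 (by simp)).const_add _

theorem trajectory_from (h : LocallyMinimal v δ α β x) (r t : ℝ) :
    x t = x r + ∫ s in r..t, α s := by
  have hi := integrableOn_of_measurable_bounded h.stronglyMeasurable_fst h.norm_fst_le
  rw [h.trajectory t, h.trajectory r, add_assoc,
    intervalIntegral.integral_add_adjacent_intervals (hi 0 r) (hi r t)]

/-- If `x` vanished on an interval, then both controls would vanish a.e. there, against `‖α‖² + ‖β‖²
= v² > 0`. -/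
theorem integral_norm_sq_pos (h : LocallyMinimal v δ α β x) (hv : 0 < v) {r s : ℝ} (hr : 0 ≤ r)
    (hrs : r < s) (hs : s ≤ 1) : 0 < ∫ t in r..s, ‖x t‖ ^ 2 := by
  by_cases hx : ∃ t ∈ Icc r s, 0 < ‖x t‖ ^ 2
  · exact intervalIntegral.integral_pos hrs (by have := h.continuous; fun_prop)
      (fun t _ => by positivity) hx
  exfalso
  push Not at hx
  have hx0 : EqOn x 0 (Icc r s) := fun t ht => by
    have := le_antisymm (hx t ht) (by positivity)
    simpa using this
  refine not_ae_false hrs ?_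
  filter_upwards [h.norm_sq, h.snd_eq_zero, h.ae_hasDerivAt] with t h1 h2 h3 ht
  have htI : t ∈ Icc (0 : ℝ) 1 := ⟨hr.trans ht.1.le, ht.2.le.trans hs⟩
  have hα : α t = 0 := by
    rw [← (h3 htI).deriv,
      (Filter.eventuallyEq_of_mem (Icc_mem_nhds ht.1 ht.2) hx0).deriv_eq]
    simp
  have hβ := h2 htI (hx0 (Ioo_subset_Icc_self ht))
  have := h1 htI
  rw [hα, hβ] at this
  simp at this
  exact (pow_pos hv 2).ne this

theorem energy_eq (h : LocallyMinimal v δ α β x) {r s : ℝ} (hr : 0 ≤ r) (hrs : r < s)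
    (hs : s ≤ 1) :
    (s - r) * v ^ 2 = (∫ t in r..s, ‖α t‖ ^ 2) + ∫ t in r..s, ‖β t‖ ^ 2 := by
  rw [← intervalIntegral.integral_add
    (intervalIntegrable_norm_sq h.stronglyMeasurable_fst h.norm_fst_le r s)
    (intervalIntegrable_norm_sq h.stronglyMeasurable_snd h.norm_snd_le r s)]
  have : ∫ t in r..s, ‖α t‖ ^ 2 + ‖β t‖ ^ 2 = ∫ t in r..s, v ^ 2 := by
    refine intervalIntegral.integral_congr_ae ?_
    filter_upwards [h.norm_sq] with t h1 ht
    rw [uIoc_of_le hrs.le] at ht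
    exact h1 ⟨hr.trans ht.1.le, ht.2.trans hs⟩
  rw [this]; simp

/-- The multiplier of a minimal trajectory on `[r, s]`. -/
noncomputable def multiplier (β x : ℝ → EuclideanSpace ℝ (Fin n)) (r s : ℝ) : ℝ :=
  (∫ t in r..s, inner ℝ (β t) (x t)) / ∫ t in r..s, ‖x t‖ ^ 2

/-- The competitor is `x` itself with the optimal second control. Minimality gives `∫ ‖β‖² ≤ D² /
G`, while `∫ ‖β - l x‖² = ∫ ‖β‖² - D² / G` for `l = D / G`; so this integral vanishes. -/
theorem snd_sub_multiplier (h : LocallyMinimal v δ α β x) (hv : 0 < v) {r s : ℝ} (hr : 0 ≤ r)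
    (hrs : r < s) (hs : s ≤ 1) (hd : s - r < δ) :
    (∫ t in r..s, ‖β t‖ ^ 2 =
      (∫ t in r..s, inner ℝ (β t) (x t)) ^ 2 / ∫ t in r..s, ‖x t‖ ^ 2) ∧
    ∀ᵐ t, t ∈ Icc r s → β t = multiplier β x r s • x t := by
  have hG := h.integral_norm_sq_pos hv hr hrs hs
  have hmin := h.minimal r s hr hrs hs hd α x v h.stronglyMeasurable_fst h.norm_fst_le
    (h.trajectory_from r) rfl rfl hG
  rw [h.energy_eq hr hrs hs, add_le_add_iff_left] at hmin
  set G := ∫ t in r..s, ‖x t‖ ^ 2 with hGd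
  set D := ∫ t in r..s, inner ℝ (β t) (x t) with hDd
  have hl : multiplier β x r s = D / G := rfl
  set l := multiplier β x r s
  have hβ2 := intervalIntegrable_norm_sq h.stronglyMeasurable_snd h.norm_snd_le r s
  have hβx := intervalIntegrable_inner_of_bounded h.stronglyMeasurable_snd h.norm_snd_le
    h.continuous r s
  have hx2 : IntervalIntegrable (fun t => ‖x t‖ ^ 2) volume r s :=
    (h.continuous.norm.pow 2).intervalIntegrable r s
  have e (t : ℝ) : ‖β t - l • x t‖ ^ 2 =
      ‖β t‖ ^ 2 - 2 * l * inner ℝ (β t) (x t) + l ^ 2 * ‖x t‖ ^ 2 := by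
    rw [norm_sub_sq_real, real_inner_smul_right, norm_smul, mul_pow, Real.norm_eq_abs, sq_abs]
    ring
  have hi : IntervalIntegrable (fun t => ‖β t - l • x t‖ ^ 2) volume r s := by
    simp only [e]
    exact (hβ2.sub (hβx.const_mul _)).add (hx2.const_mul _)
  have he : ∫ t in r..s, ‖β t - l • x t‖ ^ 2 = (∫ t in r..s, ‖β t‖ ^ 2) - D ^ 2 / G := by
    simp only [e]
    rw [intervalIntegral.integral_add (hβ2.sub (hβx.const_mul _)) (hx2.const_mul _),
      intervalIntegral.integral_sub hβ2 (hβx.const_mul _), intervalIntegral.integral_const_mul,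
      intervalIntegral.integral_const_mul, ← hGd, ← hDd, hl]
    field_simp
    ring
  have h0 : 0 ≤ ∫ t in r..s, ‖β t - l • x t‖ ^ 2 :=
    intervalIntegral.integral_nonneg hrs.le fun t _ => by positivity
  refine ⟨by linarith, ?_⟩
  filter_upwards [ae_eq_zero_of_integral_norm_sq_le hrs hi (by linarith)] with t ht hm
  exact sub_eq_zero.1 (ht hm)

/-- The competitors are `x + ε φ` with `φ` the primitive of `ψ`; the mean zero condition on `ψ`
keeps both endpoints fixed. -/
theorem first_variation (h : LocallyMinimal v δ α β x) (hv : 0 < v) {r s : ℝ} (hr : 0 ≤ r)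
    (hrs : r < s) (hs : s ≤ 1) (hd : s - r < δ) {ψ : ℝ → EuclideanSpace ℝ (Fin n)} {K : ℝ}
    (hψ : StronglyMeasurable ψ) (hψK : ∀ t, ‖ψ t‖ ≤ K) (hψ0 : ∫ t in r..s, ψ t = 0) :
    ∫ t in r..s, inner ℝ (α t) (ψ t) =
      multiplier β x r s ^ 2 * ∫ t in r..s, inner ℝ (x t) (∫ t' in r..t, ψ t') := by
  have hψi := integrableOn_of_measurable_bounded hψ hψK
  have hαi := integrableOn_of_measurable_bounded h.stronglyMeasurable_fst h.norm_fst_le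
  set φ : ℝ → EuclideanSpace ℝ (Fin n) := fun t => ∫ t' in r..t, ψ t' with hφ
  have hφc : Continuous φ := intervalIntegral.continuous_primitive hψi r
  have hxc := h.continuous
  have hφr : φ r = 0 := by simp [hφ]
  refine first_variation_eq_zero (A := ∫ t in r..s, ‖α t‖ ^ 2) (C := ∫ t in r..s, ‖ψ t‖ ^ 2)
    (K := ∫ t in r..s, ‖φ t‖ ^ 2) (h.integral_norm_sq_pos hv hr hrs hs) fun ε hε => ?_
  have e (a b : EuclideanSpace ℝ (Fin n)) :
      ‖a + ε • b‖ ^ 2 = ‖a‖ ^ 2 + 2 * ε * inner ℝ a b + ε ^ 2 * ‖b‖ ^ 2 := by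
    rw [norm_add_sq_real, real_inner_smul_right, norm_smul, mul_pow, Real.norm_eq_abs, sq_abs]
    ring
  have e1 : ∫ t in r..s, ‖α t + ε • ψ t‖ ^ 2 = (∫ t in r..s, ‖α t‖ ^ 2) +
      2 * ε * (∫ t in r..s, inner ℝ (α t) (ψ t)) + ε ^ 2 * ∫ t in r..s, ‖ψ t‖ ^ 2 := by
    have i1 := intervalIntegrable_norm_sq h.stronglyMeasurable_fst h.norm_fst_le r s
    have i2 := intervalIntegrable_norm_sq hψ hψK r s
    have i3 := intervalIntegrable_inner h.stronglyMeasurable_fst h.norm_fst_le hψ hψK r s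
    simp only [e]
    rw [intervalIntegral.integral_add (i1.add (i3.const_mul _)) (i2.const_mul _),
      intervalIntegral.integral_add i1 (i3.const_mul _), intervalIntegral.integral_const_mul,
      intervalIntegral.integral_const_mul]
  have e2 : ∫ t in r..s, ‖x t + ε • φ t‖ ^ 2 = (∫ t in r..s, ‖x t‖ ^ 2) +
      2 * ε * (∫ t in r..s, inner ℝ (x t) (φ t)) + ε ^ 2 * ∫ t in r..s, ‖φ t‖ ^ 2 := by
    have i1 : IntervalIntegrable (fun t => ‖x t‖ ^ 2) volume r s :=
      (hxc.norm.pow 2).intervalIntegrable r s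
    have i2 : IntervalIntegrable (fun t => ‖φ t‖ ^ 2) volume r s :=
      (hφc.norm.pow 2).intervalIntegrable r s
    have i3 : IntervalIntegrable (fun t => (inner ℝ (x t) (φ t) : ℝ)) volume r s :=
      (hxc.inner hφc).intervalIntegrable r s
    simp only [e]
    rw [intervalIntegral.integral_add (i1.add (i3.const_mul _)) (i2.const_mul _),
      intervalIntegral.integral_add i1 (i3.const_mul _), intervalIntegral.integral_const_mul,
      intervalIntegral.integral_const_mul]
  have hmin := h.minimal r s hr hrs hs hd (fun t => α t + ε • ψ t) (fun t => x t + ε • φ t)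
    (v + |ε| * K) (h.stronglyMeasurable_fst.add (hψ.const_smul ε))
    (fun t => (norm_add_le _ _).trans (add_le_add (h.norm_fst_le t) (by
      rw [norm_smul, Real.norm_eq_abs]
      exact mul_le_mul_of_nonneg_left (hψK t) (abs_nonneg ε))))
    (fun t => by
      have hψε : IntervalIntegrable (fun s => ε • ψ s) volume r t := (hψi r t).smul ε
      rw [intervalIntegral.integral_add (hαi r t) hψε,
        intervalIntegral.integral_smul, hφr, h.trajectory_from r t]
      simp only [hφ, smul_zero, add_zero]
      abel)
    (by simp [hφr]) (by simp [hφ, hψ0]) (by rw [e2]; exact hε)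
  rwa [e1, e2, h.energy_eq hr hrs hs, (h.snd_sub_multiplier hv hr hrs hs hd).1] at hmin

/-- Integration by parts; the boundary terms vanish because the primitive of `ψ` is zero at `r` and
`s`. -/
theorem integral_inner_primitive (h : LocallyMinimal v δ α β x) {r s : ℝ}
    (hrs : r < s) {ψ : ℝ → EuclideanSpace ℝ (Fin n)} {K : ℝ}
    (hψ : StronglyMeasurable ψ) (hψK : ∀ t, ‖ψ t‖ ≤ K) (hψ0 : ∫ t in r..s, ψ t = 0) :
    ∫ t in r..s, inner ℝ (x t) (∫ t' in r..t, ψ t') =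
      - ∫ t in r..s, inner ℝ (∫ t' in (0 : ℝ)..t, x t') (ψ t) := by
  have hψi := integrableOn_of_measurable_bounded hψ hψK
  have hK0 : 0 ≤ K := (norm_nonneg _).trans (hψK 0)
  have hxc := h.continuous
  have hX (t : ℝ) : HasDerivAt (fun t => ∫ t' in (0 : ℝ)..t, x t') (x t) t :=
    intervalIntegral.integral_hasDerivAt_right (hxc.intervalIntegrable _ _)
      (hxc.stronglyMeasurableAtFilter _ _) hxc.continuousAt
  have hXc : Continuous fun t => ∫ t' in (0 : ℝ)..t, x t' :=
    continuous_iff_continuousAt.2 fun t => (hX t).continuousAt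
  have hφc : Continuous fun t => ∫ t' in r..t, ψ t' := intervalIntegral.continuous_primitive hψi r
  have hXac : AbsolutelyContinuousOnInterval (fun t => ∫ t' in (0 : ℝ)..t, x t') r s := by
    have : ContDiff ℝ 1 fun t => ∫ t' in (0 : ℝ)..t, x t' := by
      rw [contDiff_one_iff_deriv]
      refine ⟨fun t => (hX t).differentiableAt, ?_⟩
      rw [funext fun t => (hX t).deriv]
      exact hxc
    exact this.contDiffOn.absolutelyContinuousOnInterval
  have hφac : AbsolutelyContinuousOnInterval (fun t => ∫ t' in r..t, ψ t') r s := by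
    have := lipschitzOnWith_primitive (a := r) (b := s) (K := ⟨K, hK0⟩) (fun t _ => hψi r t)
      fun t _ => hψK t
    rw [← uIcc_of_le hrs.le] at this
    exact this.absolutelyContinuousOnInterval
  have key := (integral_eq_sub_of_absolutelyContinuous (f' := fun t =>
    inner ℝ (∫ t' in (0 : ℝ)..t, x t') (ψ t) + inner ℝ (x t) (∫ t' in r..t, ψ t')) hrs.le
    (absolutelyContinuous_inner hXac hφac) (by
      filter_upwards [(hψi r s).ae_hasDerivAt_integral] with t h1 ht
      exact (hX t).inner ℝ (h1 (by rwa [uIcc_of_le hrs.le]) r (by simp)))).2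
  have i1 : IntervalIntegrable (fun t => (inner ℝ (∫ t' in (0 : ℝ)..t, x t') (ψ t) : ℝ))
      volume r s := by
    simpa only [real_inner_comm] using intervalIntegrable_inner_of_bounded hψ hψK hXc r s
  rw [intervalIntegral.integral_add i1 ((hxc.inner hφc).intervalIntegrable r s), hψ0] at key
  simp only [inner_zero_right, intervalIntegral.integral_same, sub_zero] at key
  linarith

/-- Du Bois-Reymond: by the first variation, `α + l² ∫ x` is orthogonal to every bounded measurable
`ψ` of mean zero, hence to its own deviation from its mean `C`, which therefore vanishes a.e. -/
theorem fst_eq_sub_multiplier (h : LocallyMinimal v δ α β x) (hv : 0 < v) {r s : ℝ} (hr : 0 ≤ r)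
    (hrs : r < s) (hs : s ≤ 1) (hd : s - r < δ) :
    ∃ C, ∀ᵐ t, t ∈ Icc r s →
      α t = C - multiplier β x r s ^ 2 • ∫ t' in (0 : ℝ)..t, x t' := by
  set l := multiplier β x r s
  have hxc := h.continuous
  set X : ℝ → EuclideanSpace ℝ (Fin n) := fun t => ∫ t' in (0 : ℝ)..t, x t' with hX
  have hXc : Continuous X :=
    intervalIntegral.continuous_primitive (fun a b => hxc.intervalIntegrable a b) 0
  have hgi : IntervalIntegrable (fun t => α t + l ^ 2 • X t) volume r s :=
    (integrableOn_of_measurable_bounded h.stronglyMeasurable_fst h.norm_fst_le r s).add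
      ((hXc.const_smul (l ^ 2)).intervalIntegrable r s)
  set C := (s - r)⁻¹ • ∫ t in r..s, α t + l ^ 2 • X t with hC
  set ψ := (Icc r s).indicator fun t => α t + l ^ 2 • X t - C with hψd
  have hψe : ∀ t ∈ Icc r s, ψ t = α t + l ^ 2 • X t - C := fun t ht => indicator_of_mem ht _
  have hψ : StronglyMeasurable ψ :=
    ((h.stronglyMeasurable_fst.add (hXc.const_smul (l ^ 2)).stronglyMeasurable).sub
      stronglyMeasurable_const).indicator measurableSet_Icc
  obtain ⟨D, hD⟩ := isCompact_Icc.exists_bound_of_continuousOn (s := Icc r s)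
    (f := fun t => l ^ 2 • X t - C) (by fun_prop)
  have hD0 : 0 ≤ D := (norm_nonneg _).trans (hD r (left_mem_Icc.2 hrs.le))
  have hψK (t : ℝ) : ‖ψ t‖ ≤ v + D := by
    by_cases ht : t ∈ Icc r s
    · rw [hψe t ht, add_sub_assoc]
      exact (norm_add_le _ _).trans (add_le_add (h.norm_fst_le t) (hD t ht))
    · rw [hψd, indicator_of_notMem ht, norm_zero]
      positivity
  have hψ0 : ∫ t in r..s, ψ t = 0 := by
    have : ∫ t in r..s, ψ t = ∫ t in r..s, (α t + l ^ 2 • X t - C) := by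
      refine intervalIntegral.integral_congr fun t ht => hψe t ?_
      rwa [uIcc_of_le hrs.le] at ht
    rw [this, intervalIntegral.integral_sub hgi (by simp), intervalIntegral.integral_const, hC,
      smul_smul, mul_inv_cancel₀ (sub_pos.2 hrs).ne', one_smul, sub_self]
  have h1 := h.first_variation hv hr hrs hs hd hψ hψK hψ0
  rw [h.integral_inner_primitive hrs hψ hψK hψ0] at h1
  have iα := intervalIntegrable_inner h.stronglyMeasurable_fst h.norm_fst_le hψ hψK r s
  have iX : IntervalIntegrable (fun t => (inner ℝ (X t) (ψ t) : ℝ)) volume r s := by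
    simpa only [real_inner_comm] using intervalIntegrable_inner_of_bounded hψ hψK hXc r s
  have iC : IntervalIntegrable (fun t => (inner ℝ C (ψ t) : ℝ)) volume r s :=
    intervalIntegrable_inner (K := ‖C‖) stronglyMeasurable_const (fun _ => le_rfl) hψ hψK r s
  have hCψ : ∫ t in r..s, (inner ℝ C (ψ t) : ℝ) = 0 :=
    ((innerSL ℝ C).intervalIntegral_comp_comm
      (integrableOn_of_measurable_bounded hψ hψK r s)).trans (by rw [hψ0, map_zero])
  have h2 : ∫ t in r..s, ‖ψ t‖ ^ 2 =
      ∫ t in r..s, (inner ℝ (α t) (ψ t) + l ^ 2 * inner ℝ (X t) (ψ t) - inner ℝ C (ψ t)) := by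
    refine intervalIntegral.integral_congr fun t ht => ?_
    rw [uIcc_of_le hrs.le] at ht
    rw [← real_inner_self_eq_norm_sq, ← real_inner_smul_left, ← inner_add_left, ← inner_sub_left,
      ← hψe t ht]
  rw [intervalIntegral.integral_sub (iα.add (iX.const_mul _)) iC,
    intervalIntegral.integral_add iα (iX.const_mul _), intervalIntegral.integral_const_mul, hCψ,
    h1] at h2
  refine ⟨C, ?_⟩
  filter_upwards [ae_eq_zero_of_integral_norm_sq_le hrs (intervalIntegrable_norm_sq hψ hψK r s)
    (by rw [h2]; simp [l, X])] with t ht hm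
  have := ht hm
  rw [hψe t hm] at this
  rw [eq_sub_iff_add_eq]
  exact sub_eq_zero.1 this

/-- The controls satisfy the Euler–Lagrange equations on `[r, s]`, with multiplier `l` and constant
of integration `C`. -/
def EulerLagrangeOn (α β x : ℝ → EuclideanSpace ℝ (Fin n)) (l : ℝ) (C : EuclideanSpace ℝ (Fin n))
    (r s : ℝ) : Prop :=
  ∀ᵐ t, t ∈ Icc r s → β t = l • x t ∧ α t = C - l ^ 2 • ∫ t' in (0 : ℝ)..t, x t'

theorem exists_eulerLagrangeOn_of_sub_lt (h : LocallyMinimal v δ α β x) (hv : 0 < v) {r s : ℝ}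
    (hr : 0 ≤ r) (hrs : r < s) (hs : s ≤ 1) (hd : s - r < δ) :
    ∃ l C, EulerLagrangeOn α β x l C r s := by
  obtain ⟨C, hC⟩ := h.fst_eq_sub_multiplier hv hr hrs hs hd
  refine ⟨multiplier β x r s, C, ?_⟩
  filter_upwards [hC, (h.snd_sub_multiplier hv hr hrs hs hd).2] with t h1 h2 ht
  exact ⟨h2 ht, h1 ht⟩

/-- Different multipliers would force `x = 0` on an interval. -/
theorem eulerLagrangeOn_unique (h : LocallyMinimal v δ α β x) (hv : 0 < v) {r s : ℝ}
    (hr : 0 ≤ r) (hrs : r < s) (hs : s ≤ 1) {l l' : ℝ} {C C' : EuclideanSpace ℝ (Fin n)}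
    (h1 : EulerLagrangeOn α β x l C r s) (h2 : EulerLagrangeOn α β x l' C' r s) :
    l = l' ∧ C = C' := by
  have hl : l = l' := by
    by_contra hne
    have hx : ∀ᵐ t, t ∈ Icc r s → x t = 0 := by
      filter_upwards [h1, h2] with t h1 h2 ht
      have : (l - l') • x t = 0 := by rw [sub_smul, ← (h1 ht).1, ← (h2 ht).1, sub_self]
      exact (smul_eq_zero.1 this).resolve_left (sub_ne_zero.2 hne)
    have h0 : ∫ t in r..s, ‖x t‖ ^ 2 = 0 := by
      refine intervalIntegral.integral_zero_ae ?_
      filter_upwards [hx] with t hx ht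
      rw [uIoc_of_le hrs.le] at ht
      simp [hx (Ioc_subset_Icc_self ht)]
    exact (h.integral_norm_sq_pos hv hr hrs hs).ne' h0
  refine ⟨hl, ?_⟩
  by_contra hne
  refine not_ae_false hrs ?_
  filter_upwards [h1, h2] with t h1 h2 ht
  have ht' := Ioo_subset_Icc_self ht
  have := (h1 ht').2.symm.trans (h2 ht').2
  rw [hl] at this
  exact hne (sub_left_injective this)

theorem exists_eulerLagrangeOn (h : LocallyMinimal v δ α β x) (hδ : 0 < δ) (hv : 0 < v) :
    ∃ l C, EulerLagrangeOn α β x l C 0 1 := by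
  -- The pieces `[k/N, (k+2)/N]` are shorter than `δ`, and each overlaps the part already treated in
  -- `[k/N, (k+1)/N]`, where uniqueness identifies the constants.
  obtain ⟨N, hN⟩ := exists_nat_gt (max 1 (2 / δ))
  have hN1 : (1 : ℝ) < N := (le_max_left _ _).trans_lt hN
  have hN0 : (0 : ℝ) < N := zero_lt_one.trans hN1
  have hNδ : 2 / (N : ℝ) < δ := by
    rw [div_lt_comm₀ hN0 hδ]
    exact (le_max_right _ _).trans_lt hN
  have key : ∀ k : ℕ, k + 1 ≤ N → ∃ l C, EulerLagrangeOn α β x l C 0 ((k + 1 : ℕ) / (N : ℝ)) := by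
    intro k
    induction k with
    | zero =>
      intro _
      refine h.exists_eulerLagrangeOn_of_sub_lt hv le_rfl (by positivity) ?_ ?_
      · rw [div_le_one hN0]; simpa using hN1.le
      · refine lt_trans ?_ hNδ
        rw [sub_zero]; gcongr; norm_num
    | succ k ih =>
      intro hk
      obtain ⟨l, C, h1⟩ := ih (by omega)
      have hk1 : (k : ℝ) / N < (k + 1 : ℕ) / (N : ℝ) := by gcongr; simp
      have hk2 : ((k + 1 : ℕ) : ℝ) / N < (k + 1 + 1 : ℕ) / (N : ℝ) := by gcongr; simp
      have hk3 : ((k + 1 + 1 : ℕ) : ℝ) / N ≤ 1 := by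
        rw [div_le_one hN0]; exact_mod_cast hk
      obtain ⟨l', C', h2⟩ := h.exists_eulerLagrangeOn_of_sub_lt hv (r := (k : ℝ) / N)
        (by positivity) (hk1.trans hk2) hk3 (by
          rw [← sub_div]; push_cast; convert hNδ using 2; ring)
      have h0 : (0 : ℝ) ≤ (k : ℝ) / N := by positivity
      obtain ⟨rfl, rfl⟩ := h.eulerLagrangeOn_unique hv h0 hk1 (hk2.le.trans hk3)
        (h1.mono fun t ht hm => ht ⟨h0.trans hm.1, hm.2⟩)
        (h2.mono fun t ht hm => ht ⟨hm.1, hm.2.trans hk2.le⟩)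
      refine ⟨l, C, ?_⟩
      filter_upwards [h1, h2] with t h1 h2 ht
      by_cases hm : t ≤ (k + 1 : ℕ) / (N : ℝ)
      · exact h1 ⟨ht.1, hm⟩
      · exact h2 ⟨(hk1.trans (not_le.1 hm)).le, ht.2⟩
  have hN' : 1 ≤ N := by exact_mod_cast hN1.le
  have := key (N - 1) (by omega)
  rwa [Nat.sub_add_cancel hN', div_self hN0.ne'] at this

end LocallyMinimal

end EulerLagrange

/-! ### Classification of the geodesics and conclusion -/

section Classification

variable {n : ℕ}

theorem LocallyMinimal.trajectory_eq {v δ : ℝ} {α β x : ℝ → EuclideanSpace ℝ (Fin n)}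
    (h : LocallyMinimal v δ α β x) (hx0 : x 0 = 0) {l : ℝ} {C : EuclideanSpace ℝ (Fin n)}
    (hl : l ≠ 0) (hEL : LocallyMinimal.EulerLagrangeOn α β x l C 0 1) :
    ∀ t ∈ Icc (0 : ℝ) 1, x t = (Real.sin (l * t) / l) • C := by
  have hxc := h.continuous
  set X : ℝ → EuclideanSpace ℝ (Fin n) := fun t => ∫ t' in (0 : ℝ)..t, x t' with hX
  have hXd (t : ℝ) : HasDerivAt X (x t) t :=
    intervalIntegral.integral_hasDerivAt_right (hxc.intervalIntegrable _ _)
      (hxc.stronglyMeasurableAtFilter _ _) hxc.continuousAt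
  set y : ℝ → EuclideanSpace ℝ (Fin n) := fun t => C - l ^ 2 • X t with hy
  have hyd (t : ℝ) : HasDerivAt y (-(l ^ 2 • x t)) t := by
    simpa using ((hXd t).const_smul (l ^ 2)).const_sub C
  have hyc : Continuous y := continuous_iff_continuousAt.2 fun t => (hyd t).continuousAt
  -- `z` agrees with `x` on `[0, 1]` but is differentiable everywhere, with `z' = y` and `y' = -l²
  -- x`: the harmonic oscillator.
  set z : ℝ → EuclideanSpace ℝ (Fin n) := fun t => ∫ s in (0 : ℝ)..t, y s with hz
  have hzd (t : ℝ) : HasDerivAt z (y t) t :=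
    intervalIntegral.integral_hasDerivAt_right (hyc.intervalIntegrable _ _)
      (hyc.stronglyMeasurableAtFilter _ _) hyc.continuousAt
  have hxz : ∀ t ∈ Icc (0 : ℝ) 1, x t = z t := by
    intro t ht
    rw [h.trajectory t, hx0, zero_add]
    refine intervalIntegral.integral_congr_ae ?_
    filter_upwards [hEL] with s hs hm
    rw [uIoc_of_le ht.1] at hm
    exact (hs ⟨hm.1.le, hm.2.trans ht.2⟩).2
  -- Rotating the phase vector `(l z, y)` back by the angle `l t` gives two conserved quantities,
  -- with initial values `0` and `C`.
  set w : ℝ → EuclideanSpace ℝ (Fin n) :=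
    fun t => (l * Real.cos (l * t)) • z t - Real.sin (l * t) • y t with hw
  set p : ℝ → EuclideanSpace ℝ (Fin n) :=
    fun t => (l * Real.sin (l * t)) • z t + Real.cos (l * t) • y t with hp
  have hlin (t : ℝ) : HasDerivAt (fun t => l * t) l t := by
    simpa using (hasDerivAt_id t).const_mul l
  have hwd : ∀ t ∈ Icc (0 : ℝ) 1, HasDerivAt w 0 t := by
    intro t ht
    refine ((((hlin t).cos.const_mul l).smul (hzd t)).sub
      ((hlin t).sin.smul (hyd t))).congr_deriv ?_
    rw [hxz t ht]
    module
  have hpd : ∀ t ∈ Icc (0 : ℝ) 1, HasDerivAt p 0 t := by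
    intro t ht
    refine ((((hlin t).sin.const_mul l).smul (hzd t)).add
      ((hlin t).cos.smul (hyd t))).congr_deriv ?_
    rw [hxz t ht]
    module
  have hconst {f : ℝ → EuclideanSpace ℝ (Fin n)} (hf : ∀ t ∈ Icc (0 : ℝ) 1, HasDerivAt f 0 t) :
      ∀ t ∈ Icc (0 : ℝ) 1, f t = f 0 :=
    constant_of_has_deriv_right_zero
      (fun t ht => (hf t ht).continuousAt.continuousWithinAt)
      fun t ht => (hf t (Ico_subset_Icc_self ht)).hasDerivWithinAt
  intro t ht
  have h1 := hconst hwd t ht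
  have h2 := hconst hpd t ht
  have hz0 : z 0 = 0 := by simp [hz]
  have hy0 : y 0 = C := by simp [hy, hX]
  simp only [hw, hp, hz0, hy0, mul_zero, Real.cos_zero, Real.sin_zero, zero_smul, smul_zero,
    sub_zero, one_smul, zero_add] at h1 h2
  have h3 : l • z t = Real.sin (l * t) • C := by
    have hsc := Real.sin_sq_add_cos_sq (l * t)
    calc l • z t = (Real.sin (l * t) ^ 2 + Real.cos (l * t) ^ 2) • l • z t := by
          rw [hsc, one_smul]
      _ = Real.cos (l * t) • ((l * Real.cos (l * t)) • z t - Real.sin (l * t) • y t) +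
          Real.sin (l * t) • ((l * Real.sin (l * t)) • z t + Real.cos (l * t) • y t) := by module
      _ = _ := by rw [h1, h2, smul_zero, zero_add]
  rw [hxz t ht, div_eq_inv_mul, mul_smul, ← h3, smul_smul, inv_mul_cancel₀ hl, one_smul]

theorem eqOn_curve_of_isGeodesicFromTo {u : ℝ} (hu : 0 < u) {γ : ℝ → Space n}
    (hγ : IsGeodesicFromTo (fields n) γ (0, 0) (0, u)) :
    ∃ m : ℕ, 1 ≤ m ∧ ∃ c : EuclideanSpace ℝ (Fin n), ‖c‖ = √(2 * m * Real.pi * u) ∧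
      EqOn γ (curve 0 0 (m * Real.pi) c) (Icc 0 1) := by
  obtain ⟨hgeo, h0, h1⟩ := hγ
  obtain ⟨v, δ, hδ, α, β, x, hmin, hγx⟩ := hgeo.exists_controls
  simp only [h0, zero_add] at hγx
  have hx0 : x 0 = 0 := by
    have := hγx 0 (by simp)
    rw [h0] at this
    exact (congrArg Prod.fst this).symm
  have hx1 : x 1 = 0 := by
    have := hγx 1 (by simp)
    rw [h1] at this
    exact (congrArg Prod.fst this).symm
  have hu1 : u = ∫ s in (0 : ℝ)..1, inner ℝ (β s) (x s) := by
    have := hγx 1 (by simp)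
    rw [h1] at this
    exact congrArg Prod.snd this
  -- A curve of zero speed or, further below, with `l = 0` gains no height, contrary to `u > 0`.
  have hv : 0 < v := by
    refine ((norm_nonneg _).trans (hmin.norm_fst_le 0)).lt_of_ne ?_
    rintro rfl
    have hβ : ∀ t, β t = 0 := fun t => norm_le_zero_iff.1 (hmin.norm_snd_le t)
    simp [hβ] at hu1
    exact hu.ne' hu1
  obtain ⟨l, C, hEL⟩ := hmin.exists_eulerLagrangeOn hδ hv
  have hint : ∀ t ∈ Icc (0 : ℝ) 1, ∫ s in (0 : ℝ)..t, inner ℝ (β s) (x s) =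
      ∫ s in (0 : ℝ)..t, l * ‖x s‖ ^ 2 := by
    intro t ht
    refine intervalIntegral.integral_congr_ae ?_
    filter_upwards [hEL] with s hs hm
    rw [uIoc_of_le ht.1] at hm
    rw [(hs ⟨hm.1.le, hm.2.trans ht.2⟩).1, real_inner_smul_left, real_inner_self_eq_norm_sq]
  have hl : l ≠ 0 := by
    rintro rfl
    rw [hint 1 (by simp)] at hu1
    simp at hu1
    exact hu.ne' hu1
  have hx := hmin.trajectory_eq hx0 hl hEL
  have heq : EqOn γ (curve 0 0 l C) (Icc 0 1) := by
    intro t ht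
    rw [hγx t ht, curve_zero_eq hl, ← hx t ht, hint t ht]
    congr 1
    have e : ∫ s in (0 : ℝ)..t, l * ‖x s‖ ^ 2 =
        ∫ s in (0 : ℝ)..t, l * ((Real.sin (l * s) / l) ^ 2 * ‖C‖ ^ 2) := by
      refine intervalIntegral.integral_congr fun s hs => ?_
      rw [uIcc_of_le ht.1] at hs
      simp only [hx s ⟨hs.1, hs.2.trans ht.2⟩, norm_smul, mul_pow, Real.norm_eq_abs, sq_abs]
    rw [e, intervalIntegral.integral_eq_sub_of_hasDerivAt
      (fun t' _ => hasDerivAt_height hl (‖C‖ ^ 2) t')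
      (Continuous.intervalIntegrable (by fun_prop) _ _)]
    simp
  have hC : C ≠ 0 := by
    rintro rfl
    have := heq (show (1 : ℝ) ∈ Icc (0 : ℝ) 1 by simp)
    rw [h1, curve_zero_eq hl] at this
    have := congrArg Prod.snd this
    simp at this
    exact hu.ne' this
  have hsin : Real.sin l = 0 := by
    have := hx 1 (by simp)
    rw [hx1, eq_comm, smul_eq_zero, mul_one] at this
    have := this.resolve_right hC
    exact (div_eq_zero_iff.1 this).resolve_right hl
  have hu2 : u = ‖C‖ ^ 2 / (2 * l) := by
    have := heq (show (1 : ℝ) ∈ Icc (0 : ℝ) 1 by simp)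
    rw [h1, curve_zero_eq hl] at this
    have := congrArg Prod.snd this
    simp only [mul_one, Real.sin_two_mul, hsin] at this
    rw [this]; field_simp; ring
  have hC2 : 0 < ‖C‖ ^ 2 := by positivity
  have hlpos : 0 < l := by
    rw [hu2] at hu
    have := (div_pos_iff_of_pos_left hC2).1 hu
    linarith
  obtain ⟨k, hk⟩ := Real.sin_eq_zero_iff.1 hsin
  have hk0 : 0 < k := by
    have : 0 < (k : ℝ) * Real.pi := hk ▸ hlpos
    exact_mod_cast (pos_iff_pos_of_mul_pos this).2 Real.pi_pos
  lift k to ℕ using hk0.le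
  rw [Int.cast_natCast] at hk
  refine ⟨k, by exact_mod_cast hk0, C, ?_, hk ▸ heq⟩
  rw [eq_comm, Real.sqrt_eq_iff_mul_self_eq_of_pos (norm_pos_iff.2 hC), hu2]
  rw [show 2 * (k : ℝ) * Real.pi = 2 * l by rw [← hk]; ring]
  field_simp

theorem length_curve_nat {m : ℕ} (hm : 1 ≤ m) {u : ℝ} {c : EuclideanSpace ℝ (Fin n)}
    (hc : ‖c‖ = √(2 * m * Real.pi * u)) {γ : ℝ → Space n}
    (h : EqOn γ (curve 0 0 (m * Real.pi) c) (Icc 0 1)) :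
    length (fields n) γ = ENNReal.ofReal √(2 * m * Real.pi * u) := by
  have hm0 : (m : ℝ) ≠ 0 := by positivity
  rw [length_of_eqOn_curve (mul_ne_zero hm0 Real.pi_ne_zero) h, hc]

theorem exists_norm_eq_of_one_le (hn : 1 ≤ n) {r : ℝ} (hr : 0 ≤ r) :
    ∃ c : EuclideanSpace ℝ (Fin n), ‖c‖ = r :=
  ⟨EuclideanSpace.single ⟨0, hn⟩ r, by simp [abs_of_nonneg hr]⟩

theorem isShortestGeodesicFromTo_iff (hn : 1 ≤ n) {u : ℝ} (hu : 0 < u) {γ : ℝ → Space n} :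
    IsShortestGeodesicFromTo (fields n) γ (0, 0) (0, u) ↔
      ∃ c : EuclideanSpace ℝ (Fin n), ‖c‖ = √(2 * Real.pi * u) ∧
        EqOn γ (curve 0 0 Real.pi c) (Icc 0 1) := by
  have hpi := Real.pi_pos
  constructor
  · rintro ⟨hγ, hshort⟩
    obtain ⟨m, hm, c, hc, h⟩ := eqOn_curve_of_isGeodesicFromTo hu hγ
    obtain ⟨c₁, hc₁⟩ := exists_norm_eq_of_one_le hn (Real.sqrt_nonneg (2 * (1 : ℕ) * Real.pi * u))
    have h1 := hshort _ (isGeodesicFromTo_of_eqOn_curve le_rfl hu hc₁ (eqOn_refl _ _))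
    rw [length_curve_nat hm hc h, length_curve_nat le_rfl hc₁ (eqOn_refl _ _),
      ENNReal.ofReal_le_ofReal_iff (Real.sqrt_nonneg _), Real.sqrt_le_sqrt_iff (by positivity)] at h1
    have h2 : m = 1 := by
      refine le_antisymm ?_ hm
      have h3 : (m : ℝ) * (2 * Real.pi * u) ≤ (1 : ℕ) * (2 * Real.pi * u) := by linarith
      exact_mod_cast le_of_mul_le_mul_right h3 (by positivity)
    subst h2
    exact ⟨c, by simpa using hc, by simpa using h⟩
  · rintro ⟨c, hc, h⟩
    have hc' : ‖c‖ = √(2 * (1 : ℕ) * Real.pi * u) := by simpa using hc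
    have h' : EqOn γ (curve 0 0 ((1 : ℕ) * Real.pi) c) (Icc 0 1) := by simpa using h
    have hγ := isGeodesicFromTo_of_eqOn_curve le_rfl hu hc' h'
    refine ⟨hγ, fun γ' hγ' => ?_⟩
    rw [length_curve_nat le_rfl hc' h']
    simpa using le_length_vertical hγ'.1.horizontal hγ'.2.1 hγ'.2.2

theorem dCC_vertical (hn : 1 ≤ n) {u : ℝ} (hu : 0 < u) :
    dCC (fields n) ((0, 0) : Space n) (0, u) = ENNReal.ofReal √(2 * Real.pi * u) := by
  refine le_antisymm ?_ (le_iInf₂ fun γ hγ => le_length_vertical hγ.1 hγ.2.1 hγ.2.2)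
  obtain ⟨c, hc⟩ := exists_norm_eq_of_one_le hn (Real.sqrt_nonneg (2 * (1 : ℕ) * Real.pi * u))
  have hγ := isGeodesicFromTo_of_eqOn_curve le_rfl hu hc (eqOn_refl _ _)
  refine iInf₂_le_of_le _ ⟨hγ.1.horizontal, hγ.2.1, hγ.2.2⟩ ?_
  rw [length_curve_nat le_rfl hc (eqOn_refl _ _)]
  simp

/-- The geodesics for different `m` are told apart by their lengths. Restriction to `[0, 1]`
discards the arbitrary values elsewhere, which would make infinitude trivial. -/
theorem infinite_geodesics (hn : 1 ≤ n) {u : ℝ} (hu : 0 < u) :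
    (Set.domRestrict (Icc (0 : ℝ) 1) ''
      {γ : ℝ → Space n | IsGeodesicFromTo (fields n) γ (0, 0) (0, u)}).Infinite := by
  have hpi := Real.pi_pos
  choose c hc using fun m : ℕ =>
    exists_norm_eq_of_one_le hn (Real.sqrt_nonneg (2 * (m + 1 : ℕ) * Real.pi * u))
  refine infinite_of_injective_forall_mem (f := fun m : ℕ =>
    (Icc (0 : ℝ) 1).domRestrict (curve 0 0 ((m + 1 : ℕ) * Real.pi) (c m))) ?_ fun m =>
      ⟨_, isGeodesicFromTo_of_eqOn_curve (by omega) hu (hc m) (eqOn_refl _ _), rfl⟩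
  intro m k hmk
  have heq : EqOn (curve 0 0 ((m + 1 : ℕ) * Real.pi) (c m))
      (curve 0 0 ((k + 1 : ℕ) * Real.pi) (c k)) (Icc 0 1) :=
    fun t ht => congrFun hmk ⟨t, ht⟩
  have h1 := length_curve_nat (by omega) (hc m) (eqOn_refl _ _)
  rw [length_curve_nat (by omega) (hc k) heq, ENNReal.ofReal_eq_ofReal_iff (Real.sqrt_nonneg _)
    (Real.sqrt_nonneg _), Real.sqrt_inj (by positivity) (by positivity)] at h1
  have h2 : ((k + 1 : ℕ) : ℝ) * (2 * Real.pi * u) = (m + 1 : ℕ) * (2 * Real.pi * u) := by linarith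
  have h3 := mul_right_cancel₀ (by positivity) h2
  have h4 : k + 1 = m + 1 := by exact_mod_cast h3
  omega

end Classification

end Grushin

theorem theorem2 (n : ℕ) (hn : 1 ≤ n) (u : ℝ) (hu : 0 < u) :
    -- the geodesics joining `(0,0)` and `(0,u)`
    (∀ γ : ℝ → Grushin.Space n,
      Grushin.IsGeodesicFromTo (Grushin.fields n) γ (0, 0) (0, u) ↔
        ∃ m : ℕ, 1 ≤ m ∧ ∃ c : EuclideanSpace ℝ (Fin n),
          ‖c‖ = Real.sqrt (2 * m * Real.pi * u) ∧
          Set.EqOn γ (Grushin.curve 0 0 (m * Real.pi) c) (Set.Icc 0 1)) ∧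
    -- there are infinitely many of them (as maps on `[0,1]`)
    (Set.domRestrict (Set.Icc (0 : ℝ) 1) ''
      {γ : ℝ → Grushin.Space n |
        Grushin.IsGeodesicFromTo (Grushin.fields n) γ (0, 0) (0, u)}).Infinite ∧
    -- their lengths
    (∀ m : ℕ, 1 ≤ m → ∀ c : EuclideanSpace ℝ (Fin n),
      ‖c‖ = Real.sqrt (2 * m * Real.pi * u) →
        Grushin.length (Grushin.fields n) (Grushin.curve 0 0 (m * Real.pi) c) =
          ENNReal.ofReal (Real.sqrt (2 * m * Real.pi * u))) ∧
    -- the shortest geodesics, which realize the Carnot–Carathéodory distance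
    (∀ γ : ℝ → Grushin.Space n,
      Grushin.IsShortestGeodesicFromTo (Grushin.fields n) γ (0, 0) (0, u) ↔
        ∃ c : EuclideanSpace ℝ (Fin n), ‖c‖ = Real.sqrt (2 * Real.pi * u) ∧
          Set.EqOn γ (Grushin.curve 0 0 Real.pi c) (Set.Icc 0 1)) ∧
    (∀ γ : ℝ → Grushin.Space n,
      Grushin.IsShortestGeodesicFromTo (Grushin.fields n) γ (0, 0) (0, u) →
        Grushin.length (Grushin.fields n) γ =
          Grushin.dCC (Grushin.fields n) ((0, 0) : Grushin.Space n) (0, u)) ∧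
    -- the Carnot–Carathéodory distance
    Grushin.dCC (Grushin.fields n) ((0, 0) : Grushin.Space n) (0, u) =
      ENNReal.ofReal (Real.sqrt (2 * Real.pi * u)) := by
  refine ⟨fun γ => ⟨Grushin.eqOn_curve_of_isGeodesicFromTo hu, ?_⟩,
    Grushin.infinite_geodesics hn hu,
    fun m hm c hc => Grushin.length_curve_nat hm hc (Set.eqOn_refl _ _),
    fun γ => Grushin.isShortestGeodesicFromTo_iff hn hu, fun γ hγ => ?_,
    Grushin.dCC_vertical hn hu⟩
  · rintro ⟨m, hm, c, hc, h⟩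
    exact Grushin.isGeodesicFromTo_of_eqOn_curve hm hu hc h
  · obtain ⟨c, hc, h⟩ := (Grushin.isShortestGeodesicFromTo_iff hn hu).1 hγ
    rw [Grushin.length_of_eqOn_curve Real.pi_ne_zero h, hc, Grushin.dCC_vertical hn hu]
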